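/- Let $Q$ be a finite bipartite quiver with vertex set $I=I_0\sqcup I_1$ and arrow set $\Omega$, where every arrow $h\in\Omega$ goes from a vertex $s(h)\in I_1$ to a vertex $t(h)\in I_0$. Fix vectors of nonnegative integers $w=(w_i,w'_i)_{i\in I}$ and $v=(v_i)_{i\in I}$, and put $W_i=\mathbb{C}^{w_i}$, $W'_i=\mathbb{C}^{w'_i}$. Let $$\mathbf{E}_w=\bigoplus_{\alpha\in I_0}\mathrm{Hom}(W'_\alpha,W_\alpha)\oplus\bigoplus_{\beta\in I_1}\mathrm{Hom}(W_\beta,W'_\beta)\oplus\bigoplus_{h\in\Omega}\mathrm{Hom}(W_{s(h)},W_{t(h)}),$$ with elements $(x_i,y_h)_{i\in I,h\in\Omega}$. Such an element determines the linear maps $$A_\alpha: W'_\alpha\oplus\bigoplus_{h:\,t(h)=\alpha}W_{s(h)}\to W_\alpha,\quad (a,(b_h)_h)\mapsto x_\alpha(a)+\sum_h y_h(b_h)\qquad(\alpha\in I_0),$$ $$A_\beta: W_\beta\to W'_\beta\oplus\bigoplus_{h:\,s(h)=\beta}W_{t(h)},\quad b\mapsto (x_\beta(b),(y_h(b))_h)\qquad(\beta\in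 I_1).$$ For a vector $u=(u_i)_{i\in I}$ of nonnegative integers let $$\mathbf{E}_{u,w}=\{\mathrm{rank}\,A_i\le u_i\ \forall i\in I\}\subseteq\mathbf{E}_w,\qquad \mathbf{E}^\circ_{u,w}=\{\mathrm{rank}\,A_i=u_i\ \forall i\in I\}\subseteq\mathbf{E}_w .$$ Let $Gr(d,E)$ be the Grassmannian of $d$-dimensional subspaces of $E$ (empty if $d>\dim E$), and $Gr(d,e)=Gr(d,\mathbb{C}^e)$. Let $\mathcal{F}_{v,w}$ be the variety of tuples $(X_i)_{i\in I}$ of subspaces $X_\alpha\subseteq W_\alpha$ ($\alpha\in I_0$) and $X_\beta\subseteq W'_\beta\oplus\bigoplus_{h:\,s(h)=\beta}X_{t(h)}$ ($\beta\in I_1$) with $\dim X_i=v_i$ for all $i$. Let $\tilde{\mathcal{F}}_{v,w}$ be the variety of all $(x_i,y_h,X_i)$ with $(x_i,y_h)\in\mathbf{E}_w$, $(X_i)\in\mathcal{F}_{v,w}$ and $\mathrm{im}\,A_i\subseteq X_i$ for all $i\in I$, and let $\pi:\tilde{\mathcal{F}}_{v,w}\to\mathbf{E}_{v,w}$ be the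 projection $(x_i,y_h,X_i)\mapsto(x_i,y_h)$. The pair $(u,w)$ is called $l$-dominant if for all $i\in I$ $$w_i\ge u_i,\qquad w'_i\ge u_i-\sum_{h:\,i-j}u_j,$$ where the sum runs over all arrows $h$ with an endpoint $i$, and $j$ is the other endpoint of $h$. All varieties are complex varieties with the Zariski topology, and $u\le v$ means $u_i\le v_i$ for all $i$. (a) For each $v'\le v$, the set $\mathbf{E}^\circ_{v',w}$ is nonempty if and only if $(v',w)$ is $l$-dominant. In this case it is nonsingular, locally closed in $\mathbf{E}_w$ and in $\mathbf{E}_{v,w}$, irreducible and rational. The variety $\mathbf{E}_{v,w}$ has the stratification $$\mathbf{E}_{v,w}=\bigcup_{v'}\mathbf{E}^\circ_{v',w},\qquad v'\le v,\ (v',w)\ l\text{-dominant},$$ that is, $\mathbf{E}_{v,w}$ is the disjoint union of these finitely many nonempty, nonsingular, locally closed strata, and the closure of $\mathbf{E}^\circ_{v',w}$ in $\mathbf{E}_{v,w}$ is contained in the union of the strata $\mathbf{E}^\circ_{v'',w}$ with $v''\le v'$. (b) For each $v'\le v$ with $(v',w)$ $l$-dominant, the restricted projection $\pi^{-1}(\mathbf{E}^\circ_{v',w})\to\mathbf{E}^\circ_{v',w}$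 is a Zariski locally trivial bundle with fiber the variety $$\mathcal{M}=\Big\{(X'_i)_{i\in I}\ \Big|\ X'_\alpha\in Gr(v_\alpha-v'_\alpha,\,w_\alpha-v'_\alpha)\ (\forall\alpha\in I_0),\ X'_\beta\in Gr\Big(v_\beta-v'_\beta,\ \mathbb{C}^{\,w'_\beta-v'_\beta+\sum_{h:\,s(h)=\beta}v'_{t(h)}}\oplus\bigoplus_{h:\,s(h)=\beta}X'_{t(h)}\Big)\ (\forall\beta\in I_1)\Big\},$$ and via $(X'_i)_{i\in I}\mapsto(X'_\alpha)_{\alpha\in I_0}$ the variety $\mathcal{M}$ is itself a Zariski locally trivial bundle over $\prod_{\alpha\in I_0}Gr(v_\alpha-v'_\alpha,\,w_\alpha-v'_\alpha)$ with fiber $\prod_{\beta\in I_1}Gr\big(v_\beta-v'_\beta,\ w'_\beta-v'_\beta+\sum_{h:\,s(h)=\beta}v_{t(h)}\big)$. In particular, via $(X_i)_{i\in I}\mapsto(X_\alpha)_{\alpha\in I_0}$ the variety $\mathcal{F}_{v,w}$ is a Zariski locally trivial bundle over $\prod_{\alpha\in I_0}Gr(v_\alpha,w_\alpha)$ with fiber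 $\prod_{\beta\in I_1}Gr\big(v_\beta,\ w'_\beta+\sum_{h:\,s(h)=\beta}v_{t(h)}\big)$. -/

import Mathlib

open Topology

noncomputable section

/-! ### Complex algebraic varieties as spaces with functions -/

/-- A (complex) *space with functions*: a topological space together with a sheaf of `ℂ`-algebras of
`ℂ`-valued functions (the regular functions), such that the non-vanishing locus of a regular
function is open and the function is invertible there.  A function on `U ⊆ X` is given by a function
on `X` of which only the values on `U` matter (see `glue`). Classical complex varieties form a full
subcategory of the spaces with functions. -/
structure SpaceWithFunctions (X : Type*) extends TopologicalSpace X where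
  /-- `IsRegularOn U f`: the set `U` is open and `f` is a regular function on `U`. -/
  IsRegularOn : Set X → (X → ℂ) → Prop
  isOpen_of_regular : ∀ {U f}, IsRegularOn U f → IsOpen[toTopologicalSpace] U
  glue : ∀ {U : Set X} {f : X → ℂ}, IsOpen[toTopologicalSpace] U →
    (∀ x ∈ U, ∃ V g, IsRegularOn V g ∧ x ∈ V ∧ ∀ y ∈ V, y ∈ U → f y = g y) → IsRegularOn U f
  restrict : ∀ {U V f}, IsRegularOn U f → IsOpen[toTopologicalSpace] V → V ⊆ U → IsRegularOn V f
  const : ∀ c : ℂ, IsRegularOn Set.univ (fun _ => c)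
  add : ∀ {U f g}, IsRegularOn U f → IsRegularOn U g → IsRegularOn U (fun x => f x + g x)
  mul : ∀ {U f g}, IsRegularOn U f → IsRegularOn U g → IsRegularOn U (fun x => f x * g x)
  isOpen_ne : ∀ {U f}, IsRegularOn U f → IsOpen[toTopologicalSpace] {x | x ∈ U ∧ f x ≠ 0}
  inv : ∀ {U f}, IsRegularOn U f → (∀ x ∈ U, f x ≠ 0) → IsRegularOn U (fun x => (f x)⁻¹)

/-- Morphisms pull back regular functions to regular functions.  (Since constants are regular
on every open set, such a map is continuous.) -/
def IsMorphism {X Y : Type*} (S : SpaceWithFunctions X) (T : SpaceWithFunctions Y)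
    (f : X → Y) : Prop :=
  ∀ U g, T.IsRegularOn U g → S.IsRegularOn (f ⁻¹' U) (g ∘ f)

/-- A bijection that is a morphism in both directions. -/
def IsIsomorphism {X Y : Type*} (S : SpaceWithFunctions X) (T : SpaceWithFunctions Y)
    (e : X ≃ Y) : Prop :=
  IsMorphism S T e ∧ IsMorphism T S e.symm

namespace SpaceWithFunctions

/-- The induced structure on a subset: the subspace topology, and the functions that are
locally restrictions of regular functions. -/
def sub {X : Type*} (S : SpaceWithFunctions X) (s : Set X) : SpaceWithFunctions s where
  toTopologicalSpace := S.toTopologicalSpace.induced Subtype.val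
  IsRegularOn U f := IsOpen[S.toTopologicalSpace.induced Subtype.val] U ∧
    ∀ x ∈ U, ∃ V g, S.IsRegularOn V g ∧ x.1 ∈ V ∧ ∀ y : s, y.1 ∈ V → y ∈ U → f y = g y.1
  isOpen_of_regular h := h.1
  glue {U f} hU h := by
    let _ := S.toTopologicalSpace
    refine ⟨hU, fun x hx => ?_⟩
    obtain ⟨V, g, ⟨hV, hg⟩, hxV, hfg⟩ := h x hx
    obtain ⟨V', g', hg', hxV', hgg'⟩ := hg x hxV
    obtain ⟨O, hO, rfl⟩ := hV
    exact ⟨V' ∩ O, g', S.restrict hg' ((S.isOpen_of_regular hg').inter hO) Set.inter_subset_left,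
      ⟨hxV', hxV⟩, fun y hy hyU => (hfg y hy.2 hyU).trans (hgg' y hy.1 hy.2)⟩
  restrict {U V f} h hV hVU := by
    refine ⟨hV, fun x hx => ?_⟩
    obtain ⟨O, g, hg, hxO, hfg⟩ := h.2 x (hVU hx)
    exact ⟨O, g, hg, hxO, fun y hy hyV => hfg y hy (hVU hyV)⟩
  const c := by
    let _ := S.toTopologicalSpace
    exact ⟨isOpen_univ, fun x _ => ⟨Set.univ, _, S.const c, trivial, fun _ _ _ => rfl⟩⟩
  add {U f g} hf hg := by
    let _ := S.toTopologicalSpace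
    refine ⟨hf.1, fun x hx => ?_⟩
    obtain ⟨V, f', hf', hxV, hff'⟩ := hf.2 x hx
    obtain ⟨V', g', hg', hxV', hgg'⟩ := hg.2 x hx
    have ho := (S.isOpen_of_regular hf').inter (S.isOpen_of_regular hg')
    refine ⟨V ∩ V', _, S.add (S.restrict hf' ho Set.inter_subset_left)
      (S.restrict hg' ho Set.inter_subset_right), ⟨hxV, hxV'⟩, fun y hy hyU => ?_⟩
    exact congrArg₂ _ (hff' y hy.1 hyU) (hgg' y hy.2 hyU)
  mul {U f g} hf hg := by
    let _ := S.toTopologicalSpace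
    refine ⟨hf.1, fun x hx => ?_⟩
    obtain ⟨V, f', hf', hxV, hff'⟩ := hf.2 x hx
    obtain ⟨V', g', hg', hxV', hgg'⟩ := hg.2 x hx
    have ho := (S.isOpen_of_regular hf').inter (S.isOpen_of_regular hg')
    refine ⟨V ∩ V', _, S.mul (S.restrict hf' ho Set.inter_subset_left)
      (S.restrict hg' ho Set.inter_subset_right), ⟨hxV, hxV'⟩, fun y hy hyU => ?_⟩
    exact congrArg₂ _ (hff' y hy.1 hyU) (hgg' y hy.2 hyU)
  isOpen_ne {U f} hf := by
    let _ := S.toTopologicalSpace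
    refine isOpen_iff_forall_mem_open.2 fun x hx => ?_
    obtain ⟨V, f', hf', hxV, hff'⟩ := hf.2 x hx.1
    refine ⟨U ∩ Subtype.val ⁻¹' {z | z ∈ V ∧ f' z ≠ 0}, fun y hy => ⟨hy.1, ?_⟩,
      hf.1.inter ⟨_, S.isOpen_ne hf', rfl⟩, hx.1, hxV, ?_⟩
    · rw [hff' y hy.2.1 hy.1]; exact hy.2.2
    · rw [← hff' x hxV hx.1]; exact hx.2
  inv {U f} hf h0 := by
    let _ := S.toTopologicalSpace
    refine ⟨hf.1, fun x hx => ?_⟩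
    obtain ⟨V, f', hf', hxV, hff'⟩ := hf.2 x hx
    refine ⟨{z | z ∈ V ∧ f' z ≠ 0}, _, S.inv (S.restrict hf' (S.isOpen_ne hf') fun z hz => hz.1)
      fun z hz => hz.2, ⟨hxV, ?_⟩, fun y hy hyU => ?_⟩
    · rw [← hff' x hxV hx]; exact h0 x hx
    · exact congrArg _ (hff' y hy.1 hyU)

/-- The quotient structure along a map `q : X → Y`: a set is open, a function is regular, if its
pullback to `X` is. -/
def coinduced {X Y : Type*} (S : SpaceWithFunctions X) (q : X → Y) : SpaceWithFunctions Y where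
  toTopologicalSpace := S.toTopologicalSpace.coinduced q
  IsRegularOn U f := S.IsRegularOn (q ⁻¹' U) (f ∘ q)
  isOpen_of_regular h := S.isOpen_of_regular h
  glue hU h := S.glue hU fun x hx => by
    obtain ⟨V, g, hg, hxV, hfg⟩ := h (q x) hx
    exact ⟨_, _, hg, hxV, fun y hy hyU => hfg (q y) hy hyU⟩
  restrict h hV hVU := S.restrict h hV (Set.preimage_mono hVU)
  const c := S.const c
  add := S.add
  mul := S.mul
  isOpen_ne h := S.isOpen_ne h
  inv h h0 := S.inv h fun x hx => h0 (q x) hx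

/-- The largest structure contained in all structures of a given set of structures on `X`: a set is
open, a function is regular, if it is so for every member of the set. -/
def inf {X : Type*} (C : Set (SpaceWithFunctions X)) : SpaceWithFunctions X where
  IsOpen U := ∀ S ∈ C, IsOpen[S.toTopologicalSpace] U
  isOpen_univ S _ := S.isOpen_univ
  isOpen_inter U V hU hV S hS := S.isOpen_inter U V (hU S hS) (hV S hS)
  isOpen_sUnion s h S hS := S.isOpen_sUnion s fun t ht => h t ht S hS
  IsRegularOn U f := ∀ S ∈ C, S.IsRegularOn U f
  isOpen_of_regular h S hS := S.isOpen_of_regular (h S hS)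
  glue hU h S hS := S.glue (hU S hS) fun x hx => by
    obtain ⟨V, g, hg, hx⟩ := h x hx
    exact ⟨V, g, hg S hS, hx⟩
  restrict h hV hVU S hS := S.restrict (h S hS) (hV S hS) hVU
  const c S _ := S.const c
  add hf hg S hS := S.add (hf S hS) (hg S hS)
  mul hf hg S hS := S.mul (hf S hS) (hg S hS)
  isOpen_ne h S hS := S.isOpen_ne (h S hS)
  inv h h0 S hS := S.inv (h S hS) h0

/-- The product of two spaces with functions: the smallest structure for which
both projections are morphisms (so its topology is finer than the product topology). -/
def prod {X Y : Type*} (S : SpaceWithFunctions X) (T : SpaceWithFunctions Y) :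
    SpaceWithFunctions (X × Y) :=
  inf {R | IsMorphism R S Prod.fst ∧ IsMorphism R T Prod.snd}

/-- The product of a family of spaces with functions: the smallest structure for
which all projections are morphisms. -/
def pi {ι : Type*} {X : ι → Type*} (S : ∀ i, SpaceWithFunctions (X i)) :
    SpaceWithFunctions (∀ i, X i) :=
  inf {R | ∀ i, IsMorphism R (S i) (fun x => x i)}

/-- The local ring at `x`: the germs at `x` of functions that are regular near `x`. -/
def localRing {X : Type*} (S : SpaceWithFunctions X) (x : X) :
    Subring (Filter.Germ (@nhds X S.toTopologicalSpace x) ℂ) where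
  carrier := {a | ∃ U f, S.IsRegularOn U f ∧ x ∈ U ∧ a = (f : Filter.Germ _ ℂ)}
  one_mem' := ⟨Set.univ, _, S.const 1, trivial, rfl⟩
  zero_mem' := ⟨Set.univ, _, S.const 0, trivial, rfl⟩
  mul_mem' := by
    let _ := S.toTopologicalSpace
    rintro _ _ ⟨U, f, hf, hxU, rfl⟩ ⟨V, g, hg, hxV, rfl⟩
    have ho := (S.isOpen_of_regular hf).inter (S.isOpen_of_regular hg)
    exact ⟨U ∩ V, _, S.mul (S.restrict hf ho Set.inter_subset_left)
      (S.restrict hg ho Set.inter_subset_right), ⟨hxU, hxV⟩, rfl⟩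
  add_mem' := by
    let _ := S.toTopologicalSpace
    rintro _ _ ⟨U, f, hf, hxU, rfl⟩ ⟨V, g, hg, hxV, rfl⟩
    have ho := (S.isOpen_of_regular hf).inter (S.isOpen_of_regular hg)
    exact ⟨U ∩ V, _, S.add (S.restrict hf ho Set.inter_subset_left)
      (S.restrict hg ho Set.inter_subset_right), ⟨hxU, hxV⟩, rfl⟩
  neg_mem' := by
    let _ := S.toTopologicalSpace
    rintro _ ⟨U, f, hf, hxU, rfl⟩
    refine ⟨U, _, S.mul (S.restrict (S.const (-1)) (S.isOpen_of_regular hf)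
      (Set.subset_univ U)) hf, hxU, ?_⟩
    rw [← Filter.Germ.coe_neg]
    congr 1
    funext y
    simp

/-- Nonsingular: all local rings are regular local rings. -/
def IsNonsingular {X : Type*} (S : SpaceWithFunctions X) : Prop :=
  ∀ x, IsRegularLocalRing (S.localRing x)

/-- Irreducible (in particular non-empty) in the Zariski topology. -/
def IsIrred {X : Type*} (S : SpaceWithFunctions X) : Prop :=
  @IrreducibleSpace X S.toTopologicalSpace

/-- A stratification, indexed by a finite poset: a partition into non-empty, nonsingular, locally
closed subsets such that the closure of a stratum is contained in the union of the smaller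
strata. -/
structure IsStratification {X ι : Type*} [PartialOrder ι] (S : SpaceWithFunctions X)
    (P : ι → Set X) : Prop where
  finite : Finite ι
  nonempty : ∀ i, (P i).Nonempty
  disjoint : Pairwise fun i j => Disjoint (P i) (P j)
  iUnion_eq : ⋃ i, P i = Set.univ
  isLocallyClosed : ∀ i, @IsLocallyClosed X S.toTopologicalSpace (P i)
  isNonsingular : ∀ i, (S.sub (P i)).IsNonsingular
  closure_subset : ∀ i, @closure X S.toTopologicalSpace (P i) ⊆ ⋃ j ≤ i, P j

/-- `f : X → Y` is a Zariski locally trivial bundle with fiber `F`. -/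
def IsLocallyTrivialBundle {X Y F : Type*} (S : SpaceWithFunctions X) (T : SpaceWithFunctions Y)
    (R : SpaceWithFunctions F) (f : X → Y) : Prop :=
  ∀ y, ∃ U : Set Y, IsOpen[T.toTopologicalSpace] U ∧ y ∈ U ∧
    ∃ e : (f ⁻¹' U) ≃ U × F,
      IsIsomorphism (S.sub (f ⁻¹' U)) ((T.sub U).prod R) e ∧ ∀ x, ((e x).1 : Y) = f x

end SpaceWithFunctions

/-! ### Affine spaces and Grassmannians -/

/-- The polynomial functions on a vector space: the algebra generated by the linear functionals. -/
def polyFunctions (E : Type*) [AddCommGroup E] [Module ℂ E] : Subalgebra ℂ (E → ℂ) :=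
  Algebra.adjoin ℂ (Set.range fun (l : Module.Dual ℂ E) (x : E) => l x)

/-- A finite-dimensional vector space as an affine variety: the open sets are the unions of
non-vanishing loci of polynomials, the regular functions are locally quotients of
polynomials. -/
def affineSpace (E : Type*) [AddCommGroup E] [Module ℂ E] : SpaceWithFunctions E where
  IsOpen U := ∀ x ∈ U, ∃ Q ∈ polyFunctions E, Q x ≠ 0 ∧ ∀ y, Q y ≠ 0 → y ∈ U
  isOpen_univ x _ := ⟨1, one_mem _, by simp, fun _ _ => trivial⟩
  isOpen_inter U V hU hV x hx := by
    obtain ⟨Q, hQ, hQx, hQU⟩ := hU x hx.1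
    obtain ⟨R, hR, hRx, hRV⟩ := hV x hx.2
    exact ⟨Q * R, mul_mem hQ hR, mul_ne_zero hQx hRx, fun y hy =>
      ⟨hQU y (left_ne_zero_of_mul hy), hRV y (right_ne_zero_of_mul hy)⟩⟩
  isOpen_sUnion s h x hx := by
    obtain ⟨t, ht, hxt⟩ := hx
    obtain ⟨Q, hQ, hQx, hQt⟩ := h t ht x hxt
    exact ⟨Q, hQ, hQx, fun y hy => ⟨t, ht, hQt y hy⟩⟩
  IsRegularOn U f := ∀ x ∈ U, ∃ P ∈ polyFunctions E, ∃ Q ∈ polyFunctions E,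
    Q x ≠ 0 ∧ ∀ y, Q y ≠ 0 → y ∈ U ∧ f y = P y / Q y
  isOpen_of_regular h x hx := by
    obtain ⟨P, _, Q, hQ, hQx, hy⟩ := h x hx
    exact ⟨Q, hQ, hQx, fun y h => (hy y h).1⟩
  glue {U f} hU h x hx := by
    obtain ⟨V, g, hg, hxV, hfg⟩ := h x hx
    obtain ⟨P, hP, Q, hQ, hQx, hy⟩ := hg x hxV
    obtain ⟨R, hR, hRx, hRU⟩ := hU x hx
    refine ⟨P * R, mul_mem hP hR, Q * R, mul_mem hQ hR, mul_ne_zero hQx hRx, fun y h => ?_⟩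
    have h1 : Q y ≠ 0 := left_ne_zero_of_mul h
    have h2 : R y ≠ 0 := right_ne_zero_of_mul h
    refine ⟨hRU y h2, ?_⟩
    rw [hfg y (hy y h1).1 (hRU y h2), (hy y h1).2, Pi.mul_apply, Pi.mul_apply,
      mul_div_mul_right _ _ h2]
  restrict {U V f} hf hV hVU x hx := by
    obtain ⟨P, hP, Q, hQ, hQx, hy⟩ := hf x (hVU hx)
    obtain ⟨R, hR, hRx, hRU⟩ := hV x hx
    refine ⟨P * R, mul_mem hP hR, Q * R, mul_mem hQ hR, mul_ne_zero hQx hRx, fun y h => ?_⟩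
    have h1 : Q y ≠ 0 := left_ne_zero_of_mul h
    have h2 : R y ≠ 0 := right_ne_zero_of_mul h
    refine ⟨hRU y h2, ?_⟩
    rw [(hy y h1).2, Pi.mul_apply, Pi.mul_apply, mul_div_mul_right _ _ h2]
  const c x _ := ⟨algebraMap ℂ _ c, Subalgebra.algebraMap_mem _ c, 1, one_mem _, by simp,
    fun y _ => ⟨trivial, by simp⟩⟩
  add {U f g} hf hg x hx := by
    obtain ⟨P, hP, Q, hQ, hQx, hy⟩ := hf x hx
    obtain ⟨P', hP', Q', hQ', hQx', hy'⟩ := hg x hx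
    refine ⟨P * Q' + Q * P', add_mem (mul_mem hP hQ') (mul_mem hQ hP'), Q * Q', mul_mem hQ hQ',
      mul_ne_zero hQx hQx', fun y h => ?_⟩
    have h1 : Q y ≠ 0 := left_ne_zero_of_mul h
    have h2 : Q' y ≠ 0 := right_ne_zero_of_mul h
    refine ⟨(hy y h1).1, ?_⟩
    beta_reduce
    rw [(hy y h1).2, (hy' y h2).2, div_add_div _ _ h1 h2]
    rfl
  mul {U f g} hf hg x hx := by
    obtain ⟨P, hP, Q, hQ, hQx, hy⟩ := hf x hx
    obtain ⟨P', hP', Q', hQ', hQx', hy'⟩ := hg x hx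
    refine ⟨P * P', mul_mem hP hP', Q * Q', mul_mem hQ hQ',
      mul_ne_zero hQx hQx', fun y h => ?_⟩
    have h1 : Q y ≠ 0 := left_ne_zero_of_mul h
    have h2 : Q' y ≠ 0 := right_ne_zero_of_mul h
    refine ⟨(hy y h1).1, ?_⟩
    beta_reduce
    rw [(hy y h1).2, (hy' y h2).2, div_mul_div_comm]
    rfl
  isOpen_ne {U f} hf x hx := by
    obtain ⟨P, hP, Q, hQ, hQx, hy⟩ := hf x hx.1
    have hPx : P x ≠ 0 := fun h => hx.2 (by rw [(hy x hQx).2, h, zero_div])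
    refine ⟨P * Q, mul_mem hP hQ, mul_ne_zero hPx hQx, fun y h => ?_⟩
    have h1 : P y ≠ 0 := left_ne_zero_of_mul h
    have h2 : Q y ≠ 0 := right_ne_zero_of_mul h
    exact ⟨(hy y h2).1, by rw [(hy y h2).2]; exact div_ne_zero h1 h2⟩
  inv {U f} hf h0 x hx := by
    obtain ⟨P, hP, Q, hQ, hQx, hy⟩ := hf x hx
    have hPx : P x ≠ 0 := fun h => h0 x hx (by rw [(hy x hQx).2, h, zero_div])
    refine ⟨Q * Q, mul_mem hQ hQ, P * Q, mul_mem hP hQ, mul_ne_zero hPx hQx, fun y h => ?_⟩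
    have h2 : Q y ≠ 0 := right_ne_zero_of_mul h
    refine ⟨(hy y h2).1, ?_⟩
    beta_reduce
    rw [(hy y h2).2, inv_div, Pi.mul_apply, Pi.mul_apply, mul_div_mul_right _ _ h2]

/-- Rational: irreducible, and some non-empty open subset is isomorphic to a non-empty
open subset of an affine space `ℂᵐ`. -/
def SpaceWithFunctions.IsRational {X : Type*} (S : SpaceWithFunctions X) : Prop :=
  S.IsIrred ∧ ∃ (m : ℕ) (U : Set X) (V : Set (Fin m → ℂ)),
    IsOpen[S.toTopologicalSpace] U ∧ U.Nonempty ∧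
    IsOpen[(affineSpace (Fin m → ℂ)).toTopologicalSpace] V ∧ V.Nonempty ∧
    ∃ e : U ≃ V, IsIsomorphism (S.sub U) ((affineSpace (Fin m → ℂ)).sub V) e

/-- The Grassmannian of `d`-dimensional subspaces of a finite-dimensional vector space `E`
(empty if `d > dim E`). -/
abbrev Gr (d : ℕ) (E : Type*) [AddCommGroup E] [Module ℂ E] : Type _ :=
  {X : Submodule ℂ E // Module.finrank ℂ X = d}

/-- The `d`-frames in `E`, an open subset of the affine space `Eᵈ`. -/
def frames (d : ℕ) (E : Type*) [AddCommGroup E] [Module ℂ E] : Set (Fin d → E) :=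
  {b | LinearIndependent ℂ b}

/-- The subspace spanned by a frame. -/
def frameSpan (d : ℕ) (E : Type*) [AddCommGroup E] [Module ℂ E] (b : frames d E) : Gr d E :=
  ⟨Submodule.span ℂ (Set.range b.1), by simpa using finrank_span_eq_card b.2⟩

/-- The Grassmannian as a variety: the quotient of the variety of `d`-frames by `GL_d`. -/
def grassmannian (d : ℕ) (E : Type*) [AddCommGroup E] [Module ℂ E] : SpaceWithFunctions (Gr d E) :=
  ((affineSpace (Fin d → E)).sub (frames d E)).coinduced (frameSpan d E)

/-! ### Graded quiver varieties of a bipartite quiver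

The vertex set is `I = I₀ ⊕ I₁`, and `Ω β α` is the set of arrows `β → α` for `β ∈ I₁`, `α ∈ I₀`,
so that the vertices in `I₀` are sinks and those in `I₁` are sources.  The set of arrows with
target `α` is `Σ β, Ω β α`, that of arrows with source `β` is `Σ α, Ω β α`. -/

section Quiver

variable {I₀ I₁ : Type*} [Fintype I₀] [Fintype I₁] (Ω : I₁ → I₀ → Type*) [∀ β α, Fintype (Ω β α)]

/-- `∑ v_j` over all arrows `h : i - j` with an endpoint `i`. -/
def adjacentSum (v : I₀ ⊕ I₁ → ℕ) : I₀ ⊕ I₁ → ℕ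
  | .inl α => ∑ h : (Σ β, Ω β α), v (.inr h.1)
  | .inr β => ∑ h : (Σ α, Ω β α), v (.inl h.1)

/-- `(v, w)` is `l`-dominant: `w - C_q v ≥ 0`, where `C_q v = (v_i, v_i - ∑_{h : i - j} v_j)_i`.
The dimension vector `(w_i, w'_i)_i` is given as the pair of `w` and `w'`. -/
def LDominant (v w w' : I₀ ⊕ I₁ → ℕ) : Prop :=
  ∀ i, (v i : ℤ) ≤ w i ∧ (v i : ℤ) - adjacentSum Ω v i ≤ w' i

/-- The representation space `E_w`; its elements are `(x_α, x_β, y_h)`. -/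
abbrev RepSpace (w w' : I₀ ⊕ I₁ → ℕ) : Type _ :=
  (∀ α : I₀, (Fin (w' (.inl α)) → ℂ) →ₗ[ℂ] (Fin (w (.inl α)) → ℂ)) ×
  (∀ β : I₁, (Fin (w (.inr β)) → ℂ) →ₗ[ℂ] (Fin (w' (.inr β)) → ℂ)) ×
  (∀ (β : I₁) (α : I₀), Ω β α → ((Fin (w (.inr β)) → ℂ) →ₗ[ℂ] (Fin (w (.inl α)) → ℂ)))

variable {Ω}

/-- `A_α : W'_α ⊕ ⨁_{t(h) = α} W_{s(h)} → W_α`, `(a, b) ↦ x_α a + ∑_h y_h b_h`. -/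
def sinkMap {w w' : I₀ ⊕ I₁ → ℕ} (e : RepSpace Ω w w') (α : I₀) :
    (Fin (w' (.inl α)) → ℂ) × (∀ h : (Σ β, Ω β α), Fin (w (.inr h.1)) → ℂ) →ₗ[ℂ]
      (Fin (w (.inl α)) → ℂ) :=
  (e.1 α).coprod (∑ h : (Σ β, Ω β α), e.2.2 h.1 α h.2 ∘ₗ LinearMap.proj h)

/-- `A_β : W_β → W'_β ⊕ ⨁_{s(h) = β} W_{t(h)}`, `b ↦ (x_β b, (y_h b)_h)`. -/
def sourceMap {w w' : I₀ ⊕ I₁ → ℕ} (e : RepSpace Ω w w') (β : I₁) :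
    (Fin (w (.inr β)) → ℂ) →ₗ[ℂ]
      (Fin (w' (.inr β)) → ℂ) × (∀ h : (Σ α, Ω β α), Fin (w (.inl h.1)) → ℂ) :=
  (e.2.1 β).prod (LinearMap.pi fun h : (Σ α, Ω β α) => e.2.2 β h.1 h.2)

/-- The rank of `A_i`. -/
def vertexRank {w w' : I₀ ⊕ I₁ → ℕ} (e : RepSpace Ω w w') : I₀ ⊕ I₁ → ℕ
  | .inl α => Module.finrank ℂ (LinearMap.range (sinkMap e α))
  | .inr β => Module.finrank ℂ (LinearMap.range (sourceMap e β))

variable (Ω)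

/-- The affine graded quiver variety `E_{v,w} = {rank A_i ≤ v_i for all i}`. -/
def affineQuiverVariety (v w w' : I₀ ⊕ I₁ → ℕ) : Set (RepSpace Ω w w') :=
  {e | ∀ i, vertexRank e i ≤ v i}

/-- The stratum `E°_{v,w} = {rank A_i = v_i for all i}`. -/
def stratum (v w w' : I₀ ⊕ I₁ → ℕ) : Set (RepSpace Ω w w') :=
  {e | ∀ i, vertexRank e i = v i}

/-- The space `∏_α Gr(d_α, ℂ^{a_α}) × ∏_β Gr(d_β, ℂ^{b_β} ⊕ ⨁_{s(h) = β} ℂ^{a_{t(h)}})`. -/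
abbrev GrProduct (d : I₀ ⊕ I₁ → ℕ) (a : I₀ → ℕ) (b : I₁ → ℕ) : Type _ :=
  (∀ α : I₀, Gr (d (.inl α)) (Fin (a α) → ℂ)) ×
  (∀ β : I₁, Gr (d (.inr β)) ((Fin (b β) → ℂ) × (∀ h : (Σ α, Ω β α), Fin (a h.1) → ℂ)))

/-- `GrProduct` as a variety. -/
def grProductSpace (d : I₀ ⊕ I₁ → ℕ) (a : I₀ → ℕ) (b : I₁ → ℕ) :
    SpaceWithFunctions (GrProduct Ω d a b) :=
  (SpaceWithFunctions.pi fun _ => grassmannian _ _).prod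
    (SpaceWithFunctions.pi fun _ => grassmannian _ _)

/-- The tuples `(X_i)_i` with `X_α ∈ Gr(d_α, ℂ^{a_α})` for `α ∈ I₀` and
`X_β ∈ Gr(d_β, ℂ^{b_β} ⊕ ⨁_{s(h) = β} X_{t(h)})` for `β ∈ I₁`. -/
def towerVariety (d : I₀ ⊕ I₁ → ℕ) (a : I₀ → ℕ) (b : I₁ → ℕ) : Set (GrProduct Ω d a b) :=
  {X | ∀ β, (X.2 β).1 ≤ Submodule.prod ⊤
    (Submodule.pi Set.univ fun h : (Σ α, Ω β α) => (X.1 h.1).1)}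

/-- The projection `(X_i)_{i ∈ I} ↦ (X_α)_{α ∈ I₀}`. -/
def towerProj (d : I₀ ⊕ I₁ → ℕ) (a : I₀ → ℕ) (b : I₁ → ℕ) (X : towerVariety Ω d a b) :
    ∀ α : I₀, Gr (d (.inl α)) (Fin (a α) → ℂ) :=
  X.1.1

/-- The projective variety `F_{v,w}`. -/
abbrev flagVariety (v w w' : I₀ ⊕ I₁ → ℕ) : Set (GrProduct Ω v (w ∘ .inl) (w' ∘ .inr)) :=
  towerVariety Ω v (w ∘ .inl) (w' ∘ .inr)

/-- The nonsingular graded quiver variety `F̃_{v,w}`: the pairs of a representation and a tuple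
`(X_i)_i ∈ F_{v,w}` with `im A_i ⊆ X_i` for all `i`. -/
def nonsingularQuiverVariety (v w w' : I₀ ⊕ I₁ → ℕ) :
    Set (RepSpace Ω w w' × GrProduct Ω v (w ∘ .inl) (w' ∘ .inr)) :=
  {p | p.2 ∈ flagVariety Ω v w w' ∧ (∀ α, LinearMap.range (sinkMap p.1 α) ≤ (p.2.1 α).1) ∧
    ∀ β, LinearMap.range (sourceMap p.1 β) ≤ (p.2.2 β).1}

/-- The projection `π : F̃_{v,w} → E_{v,w}`. -/
def quiverProj (v w w' : I₀ ⊕ I₁ → ℕ) (p : nonsingularQuiverVariety Ω v w w') :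
    affineQuiverVariety Ω v w w' :=
  ⟨p.1.1, fun i => match i with
    | .inl α => (Submodule.finrank_mono (p.2.2.1 α)).trans_eq (p.1.2.1 α).2
    | .inr β => (Submodule.finrank_mono (p.2.2.2 β)).trans_eq (p.1.2.2 β).2⟩

/-- `E_w` as a variety. -/
def repSpace (w w' : I₀ ⊕ I₁ → ℕ) : SpaceWithFunctions (RepSpace Ω w w') :=
  affineSpace (RepSpace Ω w w')

/-- `E_{v,w}` as a variety. -/
def affineQuiverSpace (v w w' : I₀ ⊕ I₁ → ℕ) :
    SpaceWithFunctions (affineQuiverVariety Ω v w w') :=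
  (repSpace Ω w w').sub _

/-- `F_{v,w}` as a variety. -/
def flagSpace (v w w' : I₀ ⊕ I₁ → ℕ) : SpaceWithFunctions (flagVariety Ω v w w') :=
  (grProductSpace Ω v (w ∘ .inl) (w' ∘ .inr)).sub _

/-- `F̃_{v,w}` as a variety. -/
def nonsingularQuiverSpace (v w w' : I₀ ⊕ I₁ → ℕ) :
    SpaceWithFunctions (nonsingularQuiverVariety Ω v w w') :=
  ((repSpace Ω w w').prod (grProductSpace Ω v (w ∘ .inl) (w' ∘ .inr))).sub _

/-- `E°_{u,w}` as a subset of `E_{v,w}` (for `u ≤ v` this is all of `E°_{u,w}`). -/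
def stratumIn (u v w w' : I₀ ⊕ I₁ → ℕ) : Set (affineQuiverVariety Ω v w w') :=
  Subtype.val ⁻¹' stratum Ω u w w'

/-- The dimensions `w_α - u_α`, `α ∈ I₀`. -/
def sinkDim (u w : I₀ ⊕ I₁ → ℕ) (α : I₀) : ℕ := w (.inl α) - u (.inl α)

/-- The dimensions `w'_β - u_β + ∑_{s(h) = β} u_{t(h)}`, `β ∈ I₁`; the subtraction is the honest
one if `(u, w)` is `l`-dominant. -/
def sourceDim (u w' : I₀ ⊕ I₁ → ℕ) (β : I₁) : ℕ :=
  w' (.inr β) + (∑ h : (Σ α, Ω β α), u (.inl h.1)) - u (.inr β)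

/-- The variety `M` of the tuples `(X'_i)_i` with `X'_α ∈ Gr(v_α - u_α, ℂ^{w_α - u_α})` and
`X'_β ∈ Gr(v_β - u_β, ℂ^{w'_β - u_β + ∑ u_{t(h)}} ⊕ ⨁_{s(h) = β} X'_{t(h)})`. -/
abbrev fiberVariety (u v w w' : I₀ ⊕ I₁ → ℕ) :
    Set (GrProduct Ω (v - u) (sinkDim u w) (sourceDim Ω u w')) :=
  towerVariety Ω (v - u) (sinkDim u w) (sourceDim Ω u w')

/-- `M` as a variety. -/
def fiberSpace (u v w w' : I₀ ⊕ I₁ → ℕ) : SpaceWithFunctions (fiberVariety Ω u v w w') :=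
  (grProductSpace Ω (v - u) (sinkDim u w) (sourceDim Ω u w')).sub _

end Quiver

end

/-! ### Morphisms of spaces with functions and their universal properties. -/

namespace SpaceWithFunctions

variable {X Y Z : Type*} {S : SpaceWithFunctions X} {T : SpaceWithFunctions Y}
  {R : SpaceWithFunctions Z}

/-! The engine is a normal form for representations. If `e` has ranks `u`, write the inclusion of im
A_α as an injection j_α : ℂ^{u_α} → W_α and the quotient by ker A_β as a surjection q_β : W_β →
ℂ^{u_β}. An arrow map y_h occurs both in A_{t(h)} and in A_{s(h)}, so it factors through q on the
right and j on the left. Hence `e` is the `transport` of a representation on spaces of dimensions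
`u` (`exists_transport_eq`), and transport along injections and surjections preserves ranks
(`vertexRank_transport`).

On the small spaces, A_α has a source of dimension w'_α + ∑ u_{s(h)} and A_β a target of dimension
w'_β + ∑ u_{t(h)}; bounding the ranks by these numbers gives l-dominance. Conversely, under
l-dominance each condition of full rank at one vertex is open and nonempty, so all of them hold at a
common point because affine space is irreducible (`exists_vertexRank_eq`).

The stratum is irreducible as the image under transport of an open set of triples (e', j, q) in an
affine space. Normalizing j and q by constant maps makes the triple unique near a given point; this
gives charts onto open subsets of vector spaces (`hasChartAt_stratum`), hence nonsingularity and
rationality. Lower semicontinuity of rank gives local closedness and the closure relation.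

For (b), im A_i ⊆ X_i says that X_i is the preimage of its image in coker A_i. On a stratum these
cokernels have constant dimension and can be trivialized locally, in a way compatible with the arrow
components (`exists_local_splitting`); the fibre of π becomes `fiberVariety`. The remaining bundles
come from regular local frames of the tautological subspaces (`exists_grassmannian_section`,
`isLocallyTrivialBundle_towerProj`). -/

theorem _root_.IsMorphism.comp {g : Y → Z} {f : X → Y} (hg : IsMorphism T R g)
    (hf : IsMorphism S T f) : IsMorphism S R (g ∘ f) :=
  fun U h hh => hf _ _ (hg U h hh)

theorem _root_.IsMorphism.id : IsMorphism S S id := fun _ _ h => h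

theorem isRegularOn_const {U : Set X} (hU : IsOpen[S.toTopologicalSpace] U) (c : ℂ) :
    S.IsRegularOn U fun _ => c :=
  S.restrict (S.const c) hU (Set.subset_univ U)

theorem isRegularOn_congr {U : Set X} {f g : X → ℂ} (hf : S.IsRegularOn U f)
    (h : ∀ x ∈ U, g x = f x) : S.IsRegularOn U g :=
  S.glue (S.isOpen_of_regular hf) fun _ hx => ⟨U, f, hf, hx, fun y hy _ => h y hy⟩

theorem _root_.IsMorphism.isOpen_preimage {f : X → Y} (hf : IsMorphism S T f) {U : Set Y}
    (hU : IsOpen[T.toTopologicalSpace] U) : IsOpen[S.toTopologicalSpace] (f ⁻¹' U) :=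
  S.isOpen_of_regular (hf U _ (isRegularOn_const hU 0))

/-! Subspaces -/

theorem isMorphism_val (s : Set X) : IsMorphism (S.sub s) S Subtype.val := fun U g hg =>
  ⟨⟨U, S.isOpen_of_regular hg, rfl⟩, fun _ hx => ⟨U, g, hg, hx, fun _ _ _ => rfl⟩⟩

/-- A regular function on a subspace extends only locally to the ambient space, so its pullback is
glued from the pullbacks of the local extensions. -/
theorem isMorphism_sub_iff {t : Set Y} {f : X → t} :
    IsMorphism S (T.sub t) f ↔ IsMorphism S T fun x => (f x : Y) := by
  refine ⟨fun h => (isMorphism_val t).comp h, fun h U g hg => ?_⟩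
  obtain ⟨⟨O, hO, rfl⟩, hg⟩ := hg
  refine S.glue (h.isOpen_preimage hO) fun x hx => ?_
  obtain ⟨V, g', hg', hxV, hgg'⟩ := hg (f x) hx
  exact ⟨_, _, h V g' hg', hxV, fun y hy hyU => hgg' (f y) hy hyU⟩

theorem isMorphism_restrict {f : X → Y} (hf : IsMorphism S T f) (s : Set X) :
    IsMorphism (S.sub s) T fun x => f x :=
  hf.comp (isMorphism_val s)

theorem isOpen_sub {s : Set X} (hs : IsOpen[S.toTopologicalSpace] s) {U : Set s}
    (hU : IsOpen[(S.sub s).toTopologicalSpace] U) :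
    IsOpen[S.toTopologicalSpace] (Subtype.val '' U) := by
  let _ := S.toTopologicalSpace
  exact hs.isOpenMap_subtype_val U hU

theorem isRegularOn_sub_iff {s : Set X} (hs : IsOpen[S.toTopologicalSpace] s) {U : Set s}
    {f : s → ℂ} {g : X → ℂ} (h : ∀ x : s, x ∈ U → f x = g x) :
    (S.sub s).IsRegularOn U f ↔ S.IsRegularOn (Subtype.val '' U) g := by
  constructor
  · rintro hf
    refine S.glue (isOpen_sub hs ((S.sub s).isOpen_of_regular hf)) ?_
    rintro _ ⟨x, hx, rfl⟩
    obtain ⟨V, g', hg', hxV, hgg'⟩ := hf.2 x hx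
    refine ⟨V, g', hg', hxV, ?_⟩
    rintro _ hy ⟨y, hyU, rfl⟩
    rw [← h y hyU]
    exact hgg' y hy hyU
  · intro hg
    have := isMorphism_val s _ _ hg
    rw [Set.preimage_image_eq _ Subtype.val_injective] at this
    exact isRegularOn_congr this h

/-- Being a morphism is local on the source. -/
theorem isMorphism_of_local {f : X → Y} (h : ∀ x, ∃ U : Set X, IsOpen[S.toTopologicalSpace] U ∧
    x ∈ U ∧ IsMorphism (S.sub U) T fun y => f y) : IsMorphism S T f := by
  let _ := S.toTopologicalSpace
  intro V g hg
  choose U hU hxU hf using h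
  have key (x : X) : S.IsRegularOn (U x ∩ f ⁻¹' V) (g ∘ f) := by
    have h1 := (isRegularOn_sub_iff (hU x) (g := g ∘ f) (fun _ _ => rfl)).1 (hf x V g hg)
    convert h1 using 1
    ext y
    simp [and_comm]
  refine S.glue ?_ fun x hx => ⟨_, _, key x, ⟨hxU x, hx⟩, fun _ _ _ => rfl⟩
  rw [isOpen_iff_forall_mem_open]
  exact fun x hx => ⟨_, Set.inter_subset_right, S.isOpen_of_regular (key x), hxU x, hx⟩

/-! Products and quotients -/

theorem isMorphism_fst : IsMorphism (S.prod T) S Prod.fst :=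
  fun U g hg _ hR => hR.1 U g hg

theorem isMorphism_snd : IsMorphism (S.prod T) T Prod.snd :=
  fun U g hg _ hR => hR.2 U g hg

/-- When both components are morphisms, `R.coinduced f` is one of the structures over which the
infimum defining the product is taken. A function regular for the product is therefore regular for
it, which says that its pullback along `f` is regular. -/
theorem isMorphism_prod_iff {f : Z → X × Y} : IsMorphism R (S.prod T) f ↔
    (IsMorphism R S fun z => (f z).1) ∧ IsMorphism R T fun z => (f z).2 :=
  ⟨fun h => ⟨isMorphism_fst.comp h, isMorphism_snd.comp h⟩,
    fun h _ _ hg => hg (R.coinduced f) ⟨fun U g hg => h.1 U g hg, fun U g hg => h.2 U g hg⟩⟩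

theorem isMorphism_apply {ι : Type*} {X : ι → Type*} {S : ∀ i, SpaceWithFunctions (X i)} (i : ι) :
    IsMorphism (SpaceWithFunctions.pi S) (S i) fun x => x i :=
  fun U g hg _ hR => hR i U g hg

theorem isMorphism_pi_iff {ι : Type*} {X : ι → Type*} {S : ∀ i, SpaceWithFunctions (X i)}
    {f : Z → ∀ i, X i} : IsMorphism R (SpaceWithFunctions.pi S) f ↔
      ∀ i, IsMorphism R (S i) fun z => f z i :=
  ⟨fun h i => (isMorphism_apply i).comp h,
    fun h _ _ hg => hg (R.coinduced f) fun i U g hg => h i U g hg⟩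

theorem isMorphism_coinduced (q : X → Y) : IsMorphism S (S.coinduced q) q :=
  fun _ _ hg => hg

end SpaceWithFunctions

/-! ### Regular maps into vector spaces. -/

namespace SpaceWithFunctions

variable {X Y : Type*} {S : SpaceWithFunctions X} {T : SpaceWithFunctions Y}
variable {E F G : Type*} [AddCommGroup E] [Module ℂ E] [AddCommGroup F] [Module ℂ F]
  [AddCommGroup G] [Module ℂ G]

/-- The algebra of globally regular functions. -/
def globalFunctions (S : SpaceWithFunctions X) : Subalgebra ℂ (X → ℂ) where
  carrier := {f | S.IsRegularOn Set.univ f}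
  mul_mem' := S.mul
  add_mem' := S.add
  algebraMap_mem' := S.const

theorem mem_globalFunctions {f : X → ℂ} : f ∈ S.globalFunctions ↔ S.IsRegularOn Set.univ f :=
  Iff.rfl

theorem isOpen_ne_zero {f : X → ℂ} (hf : f ∈ S.globalFunctions) :
    IsOpen[S.toTopologicalSpace] {x | f x ≠ 0} := by
  simpa using S.isOpen_ne hf

/-- A regular map to a vector space: all its linear coordinates are regular functions. -/
def IsRegularMap (S : SpaceWithFunctions X) (f : X → E) : Prop :=
  ∀ l : Module.Dual ℂ E, (fun x => l (f x)) ∈ S.globalFunctions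

theorem IsRegularMap.poly {f : X → E} (hf : S.IsRegularMap f) {P : E → ℂ}
    (hP : P ∈ polyFunctions E) : P ∘ f ∈ S.globalFunctions := by
  induction hP using Algebra.adjoin_induction with
  | mem P hP => obtain ⟨l, rfl⟩ := hP; exact hf l
  | algebraMap c => exact S.const c
  | add P Q _ _ hP hQ => exact add_mem hP hQ
  | mul P Q _ _ hP hQ => exact mul_mem hP hQ

/-- Regular functions on affine space are locally quotients P / Q. For a regular map both P ∘ f and
Q ∘ f are globally regular, and Q ∘ f can be inverted on its open non-vanishing locus. -/
theorem isMorphism_affineSpace_iff {f : X → E} :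
    IsMorphism S (affineSpace E) f ↔ S.IsRegularMap f := by
  let _ := S.toTopologicalSpace
  constructor
  · intro h l
    refine h Set.univ (fun x => l x) fun x _ => ⟨fun x => l x, Algebra.subset_adjoin ⟨l, rfl⟩, 1,
      one_mem _, by simp, fun y _ => ⟨trivial, by simp⟩⟩
  · intro h U g hg
    have key : ∀ x ∈ f ⁻¹' U, ∃ V g', S.IsRegularOn V g' ∧ x ∈ V ∧ V ⊆ f ⁻¹' U ∧
        ∀ y ∈ V, (g ∘ f) y = g' y := by
      intro x hx
      obtain ⟨P, hP, Q, hQ, hQx, hy⟩ := hg (f x) hx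
      have hO := isOpen_ne_zero (h.poly hQ)
      refine ⟨{x | (Q ∘ f) x ≠ 0}, fun x => (P ∘ f) x * ((Q ∘ f) x)⁻¹,
        S.mul (S.restrict (h.poly hP) hO (Set.subset_univ _))
          (S.inv (S.restrict (h.poly hQ) hO (Set.subset_univ _)) fun x hx => hx), hQx,
          fun y hyV => (hy _ hyV).1, fun y hyV => ?_⟩
      rw [Function.comp_apply, (hy _ hyV).2, div_eq_mul_inv]
      rfl
    refine S.glue ?_ fun x hx => ?_
    · rw [isOpen_iff_forall_mem_open]
      intro x hx
      obtain ⟨V, g', hg', hxV, hV, -⟩ := key x hx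
      exact ⟨V, hV, S.isOpen_of_regular hg', hxV⟩
    · obtain ⟨V, g', hg', hxV, -, h'⟩ := key x hx
      exact ⟨V, g', hg', hxV, fun y hy _ => h' y hy⟩

theorem IsRegularMap.comp {f : Y → E} (hf : T.IsRegularMap f) {g : X → Y}
    (hg : IsMorphism S T g) : S.IsRegularMap fun x => f (g x) :=
  fun l => hg _ _ (hf l)

theorem IsRegularMap.sub {f : X → E} (hf : S.IsRegularMap f) (s : Set X) :
    (S.sub s).IsRegularMap fun x => f x :=
  hf.comp (isMorphism_val s)

theorem isRegularMap_id : (affineSpace E).IsRegularMap (fun x : E => x) :=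
  isMorphism_affineSpace_iff.1 IsMorphism.id

theorem isRegularMap_const (c : E) : S.IsRegularMap fun _ => c := fun l => S.const (l c)

theorem IsRegularMap.add {f g : X → E} (hf : S.IsRegularMap f) (hg : S.IsRegularMap g) :
    S.IsRegularMap fun x => f x + g x := fun l => by
  simpa using! add_mem (hf l) (hg l)

theorem IsRegularMap.linear {f : X → E} (hf : S.IsRegularMap f) (L : E →ₗ[ℂ] F) :
    S.IsRegularMap fun x => L (f x) :=
  fun l => hf (l ∘ₗ L)

theorem IsRegularMap.sum {ι : Type*} (s : Finset ι) {f : ι → X → E}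
    (hf : ∀ i ∈ s, S.IsRegularMap (f i)) : S.IsRegularMap fun x => ∑ i ∈ s, f i x := fun l => by
  have := sum_mem (S := S.globalFunctions) (t := s) fun i hi => hf i hi l
  convert this using 1
  ext x
  simp

theorem IsRegularMap.sub_map {f g : X → E} (hf : S.IsRegularMap f) (hg : S.IsRegularMap g) :
    S.IsRegularMap fun x => f x - g x := fun l => by
  simpa using! sub_mem (hf l) (hg l)

theorem IsRegularMap.smul {c : X → ℂ} {f : X → E} (hc : c ∈ S.globalFunctions)
    (hf : S.IsRegularMap f) : S.IsRegularMap fun x => c x • f x := fun l => by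
  simpa using! mul_mem hc (hf l)

theorem isRegularMap_complex {f : X → ℂ} : S.IsRegularMap f ↔ f ∈ S.globalFunctions := by
  refine ⟨fun h => h LinearMap.id, fun h l => ?_⟩
  have : (fun x => l (f x)) = l 1 • f := by
    ext x
    rw [← mul_one (f x), ← smul_eq_mul (f x), map_smul]
    simp [mul_comm]
  rw [this]
  exact Subalgebra.smul_mem _ h _

/-- Expanding the first argument in a basis leaves a sum of regular scalars times linear images of
the second. Composition and evaluation of linear maps are the cases needed. -/
theorem IsRegularMap.bilinear [FiniteDimensional ℂ E] {f : X → E} {g : X → F}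
    (hf : S.IsRegularMap f) (hg : S.IsRegularMap g) (B : E →ₗ[ℂ] F →ₗ[ℂ] G) :
    S.IsRegularMap fun x => B (f x) (g x) := by
  let b := Module.finBasis ℂ E
  have : (fun x => B (f x) (g x)) = fun x => ∑ i, (b.coord i (f x)) • B (b i) (g x) := by
    ext x
    conv_lhs => rw [← b.sum_repr (f x), map_sum, LinearMap.sum_apply]
    simp
  rw [this]
  exact IsRegularMap.sum _ fun i _ => (hg.linear (B (b i))).smul (hf (b.coord i))

theorem IsRegularMap.lcomp [FiniteDimensional ℂ F] [FiniteDimensional ℂ G]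
    {g : X → F →ₗ[ℂ] G} {f : X → E →ₗ[ℂ] F}
    (hg : S.IsRegularMap g) (hf : S.IsRegularMap f) : S.IsRegularMap fun x => g x ∘ₗ f x :=
  hg.bilinear hf (LinearMap.llcomp ℂ E F G)

theorem IsRegularMap.lapply [FiniteDimensional ℂ E] [FiniteDimensional ℂ F]
    {f : X → E →ₗ[ℂ] F} {g : X → E}
    (hf : S.IsRegularMap f) (hg : S.IsRegularMap g) : S.IsRegularMap fun x => f x (g x) :=
  hf.bilinear hg LinearMap.id

theorem isRegularMap_prod {f : X → E × F} : S.IsRegularMap f ↔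
    (S.IsRegularMap fun x => (f x).1) ∧ S.IsRegularMap fun x => (f x).2 := by
  refine ⟨fun h => ⟨h.linear (LinearMap.fst ℂ E F), h.linear (LinearMap.snd ℂ E F)⟩, fun h => ?_⟩
  simpa using (h.1.linear (LinearMap.inl ℂ E F)).add (h.2.linear (LinearMap.inr ℂ E F))

theorem isRegularMap_pi {ι : Type*} [Finite ι] {E : ι → Type*} [∀ i, AddCommGroup (E i)]
    [∀ i, Module ℂ (E i)] {f : X → ∀ i, E i} :
    S.IsRegularMap f ↔ ∀ i, S.IsRegularMap fun x => f x i := by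
  classical
  have := Fintype.ofFinite ι
  refine ⟨fun h i => h.linear (LinearMap.proj i), fun h => ?_⟩
  have := IsRegularMap.sum Finset.univ fun i _ => (h i).linear (LinearMap.single ℂ E i)
  convert this using 2 with x
  simp [LinearMap.sum_single_apply]

/-- A family of linear maps is regular if it is pointwise regular. -/
theorem isRegularMap_hom_iff [FiniteDimensional ℂ E] [FiniteDimensional ℂ F] {f : X → E →ₗ[ℂ] F} :
    S.IsRegularMap f ↔ ∀ v, S.IsRegularMap fun x => f x v := by
  refine ⟨fun h v => h.lapply (isRegularMap_const v), fun h => ?_⟩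
  let b := Module.finBasis ℂ E
  have h2 : S.IsRegularMap fun x => fun i => f x (b i) := isRegularMap_pi.2 fun i => h (b i)
  have := h2.linear (b.constr ℂ (M' := F)).toLinearMap
  convert this using 2 with x
  refine b.ext fun i => ?_
  simp

theorem IsRegularMap.lprod [FiniteDimensional ℂ E] [FiniteDimensional ℂ F] [FiniteDimensional ℂ G]
    {f : X → E →ₗ[ℂ] F} {g : X → E →ₗ[ℂ] G} (hf : S.IsRegularMap f) (hg : S.IsRegularMap g) :
    S.IsRegularMap fun x => (f x).prod (g x) :=
  isRegularMap_hom_iff.2 fun v => isRegularMap_prod.2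
    ⟨isRegularMap_hom_iff.1 hf v, isRegularMap_hom_iff.1 hg v⟩

theorem IsRegularMap.lcoprod [FiniteDimensional ℂ E] [FiniteDimensional ℂ F]
    [FiniteDimensional ℂ G]
    {f : X → E →ₗ[ℂ] G} {g : X → F →ₗ[ℂ] G} (hf : S.IsRegularMap f) (hg : S.IsRegularMap g) :
    S.IsRegularMap fun x => (f x).coprod (g x) :=
  isRegularMap_hom_iff.2 fun v => by
    simpa using (isRegularMap_hom_iff.1 hf v.1).add (isRegularMap_hom_iff.1 hg v.2)

theorem IsRegularMap.lpi [FiniteDimensional ℂ E] {ι : Type*} [Finite ι] {F : ι → Type*}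
    [∀ i, AddCommGroup (F i)]
    [∀ i, Module ℂ (F i)] [∀ i, FiniteDimensional ℂ (F i)] {f : ∀ i, X → E →ₗ[ℂ] F i}
    (hf : ∀ i, S.IsRegularMap (f i)) : S.IsRegularMap fun x => LinearMap.pi fun i => f i x :=
  isRegularMap_hom_iff.2 fun v => isRegularMap_pi.2 fun i => isRegularMap_hom_iff.1 (hf i) v

/-! ### Determinants and inverses of regular families of linear maps. -/

section Inverse

variable [FiniteDimensional ℂ E]

theorem IsRegularMap.det {f : X → E →ₗ[ℂ] E} (hf : S.IsRegularMap f) :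
    (fun x => LinearMap.det (f x)) ∈ S.globalFunctions := by
  let b := Module.finBasis ℂ E
  have h (i j) : (fun x => LinearMap.toMatrix b b (f x) i j) ∈ S.globalFunctions := by
    have := (isRegularMap_hom_iff.1 hf (b j)) (b.coord i)
    simpa [LinearMap.toMatrix_apply] using this
  simp_rw [← LinearMap.det_toMatrix b, Matrix.det_apply]
  have : (fun x => ∑ σ : Equiv.Perm _, Equiv.Perm.sign σ •
      ∏ i, LinearMap.toMatrix b b (f x) (σ i) i) = ∑ σ : Equiv.Perm _, Equiv.Perm.sign σ •
      ∏ i, fun x => LinearMap.toMatrix b b (f x) (σ i) i := by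
    ext x
    simp [Finset.sum_apply, Finset.prod_apply, Units.smul_def]
  rw [this]
  refine sum_mem fun σ _ => ?_
  rw [Units.smul_def]
  exact zsmul_mem (prod_mem fun i _ => h _ _) _

theorem inv_mem_globalFunctions {f : X → ℂ} (hf : f ∈ S.globalFunctions) (h : ∀ x, f x ≠ 0) :
    (fun x => (f x)⁻¹) ∈ S.globalFunctions :=
  S.inv hf fun x _ => h x

/-- The inverse of a regular family of automorphisms, via Cramer's rule. -/
theorem IsRegularMap.exists_inverse_end {f : X → E →ₗ[ℂ] E} (hf : S.IsRegularMap f)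
    (h : ∀ x, LinearMap.det (f x) ≠ 0) : ∃ g : X → E →ₗ[ℂ] E, S.IsRegularMap g ∧
      ∀ x, g x ∘ₗ f x = LinearMap.id ∧ f x ∘ₗ g x = LinearMap.id := by
  classical
  let b := Module.finBasis ℂ E
  let M (x : X) := LinearMap.toMatrix b b (f x)
  have hM (i j) : (fun x => M x i j) ∈ S.globalFunctions := by
    have := (isRegularMap_hom_iff.1 hf (b j)) (b.coord i)
    simpa [M, LinearMap.toMatrix_apply] using this
  have hdet (x) : (M x).det ≠ 0 := by simpa [M, LinearMap.det_toMatrix] using h x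
  let N (x : X) := (M x)⁻¹
  refine ⟨fun x => Matrix.toLin b b (N x), ?_, fun x => ?_⟩
  · have hN : S.IsRegularMap N := by
      have : S.IsRegularMap fun x => fun i j => N x i j := by
        refine isRegularMap_pi.2 fun i => isRegularMap_pi.2 fun j => isRegularMap_complex.2 ?_
        -- An adjugate entry is itself the determinant of a matrix with one row replaced, so
        -- regularity of determinants applies once more.
        have e : (fun x => N x i j) = fun x => ((M x).det)⁻¹ *
            LinearMap.det (Matrix.toLin' ((M x).updateRow j (Pi.single i 1))) := by
          ext x
          rw [show N x = (M x)⁻¹ from rfl, Matrix.inv_def, Matrix.smul_apply, Matrix.adjugate_apply, LinearMap.det_toLin',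
            Ring.inverse_eq_inv', smul_eq_mul]
        rw [e]
        refine mul_mem (inv_mem_globalFunctions ?_ hdet) (IsRegularMap.det ?_)
        · simpa [M, LinearMap.det_toMatrix] using hf.det
        · refine isRegularMap_hom_iff.2 fun v => isRegularMap_pi.2 fun k => ?_
          simp only [Matrix.toLin'_apply, Matrix.mulVec, dotProduct]
          refine IsRegularMap.sum _ fun l _ => isRegularMap_complex.2 ?_
          refine mul_mem ?_ (S.const (v l))
          by_cases hk : k = j
          · subst hk; simpa using! S.const _
          · simpa [Matrix.updateRow_ne hk] using hM k l
      exact this.linear (Matrix.ofLinearEquiv ℂ).toLinearMap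
    exact hN.linear (Matrix.toLin b b).toLinearMap
  · have hu : IsUnit (M x).det := (hdet x).isUnit
    have hf' : f x = Matrix.toLin b b (M x) := by simp [M]
    beta_reduce
    rw [hf', show N x = (M x)⁻¹ from rfl, ← Matrix.toLin_mul, ← Matrix.toLin_mul, Matrix.nonsing_inv_mul _ hu,
      Matrix.mul_nonsing_inv _ hu, Matrix.toLin_one]
    exact ⟨rfl, rfl⟩

end Inverse

/-! ### Semicontinuity of rank. -/

section Rank

/-- A linear map of rank at least `k` becomes bijective on restriction to a `k`-dimensional space
and projection to a `k`-dimensional space. -/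
theorem exists_bijective_of_le_finrank_range {A : E →ₗ[ℂ] F} {k : ℕ}
    (hk : k ≤ Module.finrank ℂ (LinearMap.range A)) :
    ∃ (r : (Fin k → ℂ) →ₗ[ℂ] E) (ρ : F →ₗ[ℂ] (Fin k → ℂ)),
      ρ ∘ₗ A ∘ₗ r = LinearMap.id := by
  obtain ⟨b, hb⟩ := exists_linearIndependent_of_le_finrank hk
  choose c hc using fun i => (b i).2
  have hb' : LinearIndependent ℂ fun i => (b i : F) :=
    hb.map' (Submodule.subtype _) (Submodule.ker_subtype _)
  obtain ⟨ρ, hρ⟩ := LinearMap.exists_leftInverse_of_injective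
    (Fintype.linearCombination ℂ fun i => (b i : F))
    (by rwa [LinearMap.ker_eq_bot, ← linearIndependent_iff_injective_fintypeLinearCombination])
  refine ⟨Fintype.linearCombination ℂ c, ρ, ?_⟩
  rw [← hρ]
  congr 1
  ext i
  simp [hc]

theorem le_finrank_range_of_bijective [FiniteDimensional ℂ E] {A : E →ₗ[ℂ] F} {k : ℕ} {r : (Fin k → ℂ) →ₗ[ℂ] E}
    {ρ : F →ₗ[ℂ] (Fin k → ℂ)} (h : Function.Bijective (ρ ∘ₗ A ∘ₗ r)) :
    k ≤ Module.finrank ℂ (LinearMap.range A) := by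
  have h1 : LinearMap.range (ρ ∘ₗ A) = ⊤ := by
    rw [LinearMap.range_eq_top]
    exact Function.Surjective.of_comp (g := r) h.2
  have h2 := (LinearMap.finrank_range_le (ρ ∘ₗ (LinearMap.range A).subtype))
  rw [LinearMap.range_comp, Submodule.range_subtype, ← LinearMap.range_comp, h1] at h2
  simpa using h2

variable [FiniteDimensional ℂ E] [FiniteDimensional ℂ F]

/-- In equal dimensions a fixed isomorphism turns the family into endomorphisms, and bijectivity
into non-vanishing of a determinant; in unequal dimensions the set is empty. -/
theorem isOpen_bijective {f : X → E →ₗ[ℂ] F} (hf : S.IsRegularMap f) :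
    IsOpen[S.toTopologicalSpace] {x | Function.Bijective (f x)} := by
  let _ := S.toTopologicalSpace
  by_cases h : Module.finrank ℂ E = Module.finrank ℂ F
  · let e := LinearEquiv.ofFinrankEq E F h
    have h1 : S.IsRegularMap fun x => e.symm.toLinearMap ∘ₗ f x :=
      (isRegularMap_const _).lcomp hf
    convert isOpen_ne_zero h1.det using 1
    ext x
    simp only [Set.mem_ofPred_eq, ← isUnit_iff_ne_zero, ← LinearMap.isUnit_iff_isUnit_det,
      Module.End.isUnit_iff, LinearMap.coe_comp, LinearEquiv.coe_coe]
    exact (e.symm.bijective.of_comp_iff' _).symm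
  · convert isOpen_empty
    ext x
    simp only [Set.mem_ofPred_eq, Set.mem_empty_iff_false, iff_false]
    exact fun hx => h (LinearEquiv.ofBijective _ hx).finrank_eq

theorem IsRegularMap.exists_inverse {f : X → E →ₗ[ℂ] F} (hf : S.IsRegularMap f)
    (h : ∀ x, Function.Bijective (f x)) : ∃ g : X → F →ₗ[ℂ] E, S.IsRegularMap g ∧
      ∀ x, g x ∘ₗ f x = LinearMap.id ∧ f x ∘ₗ g x = LinearMap.id := by
  rcases isEmpty_or_nonempty X with hX | ⟨⟨x₀⟩⟩
  · exact ⟨fun _ => 0, isRegularMap_const _, fun x => hX.elim x⟩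
  let e := LinearEquiv.ofBijective _ (h x₀)
  have h1 : S.IsRegularMap fun x => e.symm.toLinearMap ∘ₗ f x := (isRegularMap_const _).lcomp hf
  obtain ⟨g, hg, hgf⟩ := h1.exists_inverse_end fun x => by
    rw [← isUnit_iff_ne_zero, ← LinearMap.isUnit_iff_isUnit_det, Module.End.isUnit_iff]
    exact e.symm.bijective.comp (h x)
  refine ⟨fun x => g x ∘ₗ e.symm.toLinearMap, hg.lcomp (isRegularMap_const _), fun x =>
    ⟨(hgf x).1, ?_⟩⟩
  have := (hgf x).2
  ext v
  have h2 := LinearMap.congr_fun this (e.symm v)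
  exact e.symm.injective h2

/-- Test maps `r` and `ρ` that detect rank `k` at one point are kept constant: bijectivity of ρ ∘ f
∘ r is an open condition and still forces rank at least `k`. -/
theorem isOpen_le_finrank_range {f : X → E →ₗ[ℂ] F} (hf : S.IsRegularMap f) (k : ℕ) :
    IsOpen[S.toTopologicalSpace] {x | k ≤ Module.finrank ℂ (LinearMap.range (f x))} := by
  let _ := S.toTopologicalSpace
  rw [isOpen_iff_forall_mem_open]
  intro x hx
  obtain ⟨r, ρ, h⟩ := exists_bijective_of_le_finrank_range hx
  refine ⟨{x | Function.Bijective (ρ ∘ₗ f x ∘ₗ r)}, fun y hy => le_finrank_range_of_bijective hy,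
    isOpen_bijective ((isRegularMap_const ρ).lcomp (hf.lcomp (isRegularMap_const r))), ?_⟩
  simp only [Set.mem_ofPred_eq, h]
  exact Function.bijective_id

end Rank

end SpaceWithFunctions

/-! ### Morphisms to Grassmannians and local frames. -/

namespace SpaceWithFunctions

theorem isMorphism_frameSpan {E : Type*} [AddCommGroup E] [Module ℂ E] (d : ℕ) :
    IsMorphism ((affineSpace (Fin d → E)).sub (frames d E))
    (grassmannian d E) (frameSpan d E) :=
  isMorphism_coinduced _

variable {X : Type*} {S : SpaceWithFunctions X}
variable {E F G : Type*} [AddCommGroup E] [Module ℂ E] [FiniteDimensional ℂ E]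
  [AddCommGroup F] [Module ℂ F] [FiniteDimensional ℂ F]
  [AddCommGroup G] [Module ℂ G] [FiniteDimensional ℂ G]

theorem IsRegularMap.linearCombination {ι : Type*} [Fintype ι] {b : X → ι → E}
    (hb : S.IsRegularMap b) : S.IsRegularMap fun x => Fintype.linearCombination ℂ (b x) :=
  isRegularMap_hom_iff.2 fun v => by
    simp only [Fintype.linearCombination_apply]
    exact IsRegularMap.sum _ fun i _ =>
      ((isRegularMap_pi.1 hb i)).linear (v i • LinearMap.id)

theorem isOpen_linearIndependent {d : ℕ} {b : X → Fin d → E} (hb : S.IsRegularMap b) :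
    IsOpen[S.toTopologicalSpace] {x | LinearIndependent ℂ (b x)} := by
  convert isOpen_le_finrank_range hb.linearCombination d using 3 with x
  rw [linearIndependent_iff_card_le_finrank_span, Fintype.range_linearCombination,
    Fintype.card_fin]
  rfl

/-- A family of subspaces of constant dimension with a regular family of generators is a morphism
to the Grassmannian. -/
theorem isMorphism_grassmannian_of_span {d : ℕ} {ι : Type*} {φ : X → Gr d E} [Finite ι]
    {b : X → ι → E} (hb : S.IsRegularMap b)
    (h : ∀ x, Submodule.span ℂ (Set.range (b x)) = (φ x).1) :
    IsMorphism S (grassmannian d E) φ := by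
  refine isMorphism_of_local fun x₀ => ?_
  -- Generators that form a basis at `x₀` stay independent nearby, and by the dimension count they
  -- still span φ x there; so φ lifts locally to frames.
  obtain ⟨κ, a, ha, hspan, hli⟩ := exists_linearIndependent' ℂ (b x₀)
  have : Finite κ := Finite.of_injective a ha
  have := Fintype.ofFinite κ
  have hcard : Fintype.card κ = d := by
    rw [← finrank_span_eq_card hli, hspan, h, (φ x₀).2]
  let e : Fin d ≃ κ := (Fintype.equivFinOfCardEq hcard).symm
  let c (x : X) (i : Fin d) : E := b x (a (e i))
  have hc : S.IsRegularMap c := isRegularMap_pi.2 fun i => isRegularMap_pi.1 hb _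
  refine ⟨{x | LinearIndependent ℂ (c x)}, isOpen_linearIndependent hc, hli.comp e e.injective, ?_⟩
  have h1 : IsMorphism (S.sub {x | LinearIndependent ℂ (c x)})
      ((affineSpace (Fin d → E)).sub (frames d E)) fun x => ⟨c x, x.2⟩ :=
    isMorphism_sub_iff.2 (isMorphism_affineSpace_iff.2 (hc.sub _))
  convert (isMorphism_frameSpan d).comp h1 using 1
  ext1 x
  refine Subtype.ext (Submodule.eq_of_le_of_finrank_eq ?_ ?_).symm
  · rw [← h]
    refine Submodule.span_mono ?_
    rintro _ ⟨i, rfl⟩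
    exact ⟨_, rfl⟩
  · exact (frameSpan d E ⟨c x, x.2⟩).2.trans (φ x).2.symm

theorem isMorphism_grassmannian_of_range {d : ℕ} {φ : X → Gr d E} {B : X → G →ₗ[ℂ] E}
    (hB : S.IsRegularMap B) (h : ∀ x, LinearMap.range (B x) = (φ x).1) :
    IsMorphism S (grassmannian d E) φ := by
  let b := Module.finBasis ℂ G
  refine isMorphism_grassmannian_of_span (b := fun x i => B x (b i))
    (isRegularMap_pi.2 fun i => isRegularMap_hom_iff.1 hB _) fun x => ?_
  rw [← h, ← Submodule.map_top, ← b.span_eq, Submodule.map_span, ← Set.range_comp]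
  rfl

/-- Locally on the Grassmannian there is a regular family of frames, with a constant retraction. -/
theorem exists_grassmannian_section {d : ℕ} (X₀ : Gr d E) : ∃ (ρ : E →ₗ[ℂ] (Fin d → ℂ))
    (U : Set (Gr d E)) (j : Gr d E → (Fin d → ℂ) →ₗ[ℂ] E),
    IsOpen[(grassmannian d E).toTopologicalSpace] U ∧ X₀ ∈ U ∧
    ((grassmannian d E).sub U).IsRegularMap (fun X => j X) ∧
    ∀ X ∈ U, ρ ∘ₗ j X = LinearMap.id ∧ LinearMap.range (j X) = X.1 := by
  classical
  let j₀ : (Fin d → ℂ) →ₗ[ℂ] E :=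
    X₀.1.subtype ∘ₗ (LinearEquiv.ofFinrankEq (Fin d → ℂ) X₀.1 (by simp [X₀.2])).toLinearMap
  have hj₀ : LinearMap.range j₀ = X₀.1 := by simp [j₀, LinearMap.range_comp]
  obtain ⟨ρ, hρ⟩ := j₀.exists_leftInverse_of_injective (by
    rw [LinearMap.ker_eq_bot]
    exact X₀.1.subtype_injective.comp (LinearEquiv.injective _))
  -- Among the frames of X at most one satisfies ρ ∘ j = id. This uniqueness lets the normalized
  -- frame descend from the variety of frames to its quotient.
  let p (X : Gr d E) (j : (Fin d → ℂ) →ₗ[ℂ] E) : Prop :=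
    ρ ∘ₗ j = LinearMap.id ∧ LinearMap.range j = X.1
  have p_unique {X j j'} (h : p X j) (h' : p X j') : j = j' := by
    ext1 i
    refine LinearMap.ext fun c => ?_
    simp only [LinearMap.comp_apply]
    generalize LinearMap.single ℂ (fun _ => ℂ) i c = a
    obtain ⟨c, hc⟩ : j a ∈ LinearMap.range j' := by rw [h'.2, ← h.2]; exact ⟨a, rfl⟩
    have h1 : ρ (j a) = a := LinearMap.congr_fun h.1 a
    have h2 : ρ (j' c) = c := LinearMap.congr_fun h'.1 c
    rw [← hc, ← h1, ← hc, h2]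
  let A := (affineSpace (Fin d → E)).sub (frames d E)
  let B (b : frames d E) := Fintype.linearCombination ℂ b.1
  have hB : A.IsRegularMap B := (isRegularMap_id.sub _).linearCombination
  have hBr (b : frames d E) : LinearMap.range (B b) = (frameSpan d E b).1 :=
    Fintype.range_linearCombination ..
  have hρB : A.IsRegularMap fun b => ρ ∘ₗ B b := (isRegularMap_const ρ).lcomp hB
  let U : Set (Gr d E) := {X | ∃ j, p X j}
  let N : Set (frames d E) := {b | Function.Bijective (ρ ∘ₗ B b)}
  have hN : IsOpen[A.toTopologicalSpace] N := isOpen_bijective hρB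
  obtain ⟨g, hg, hgB⟩ := (hρB.sub N).exists_inverse fun b => b.2
  -- Any frame whose composite with `ρ` is invertible is normalized by the inverse of that
  -- composite.
  have hpj (b : N) : p (frameSpan d E b) (B b ∘ₗ g b) := by
    refine ⟨(hgB b).2, ?_⟩
    rw [← hBr, LinearMap.range_comp, LinearMap.range_eq_top.2, Submodule.map_top]
    intro v
    exact ⟨(ρ ∘ₗ B b) v, LinearMap.congr_fun (hgB b).1 v⟩
  have hUN : frameSpan d E ⁻¹' U = N := by
    ext b
    refine ⟨?_, fun hb => ⟨_, hpj ⟨b, hb⟩⟩⟩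
    rintro ⟨j, hj⟩
    have hinj : Function.Injective (ρ ∘ₗ B b) := by
      rw [← LinearMap.ker_eq_bot, LinearMap.ker_eq_bot']
      intro v hv
      obtain ⟨c, hc⟩ : B b v ∈ LinearMap.range j := by rw [hj.2, ← hBr]; exact ⟨v, rfl⟩
      have h2 : ρ (j c) = c := LinearMap.congr_fun hj.1 c
      rw [LinearMap.comp_apply, ← hc, h2] at hv
      rw [hv, map_zero] at hc
      exact linearIndependent_iff_injective_fintypeLinearCombination.1 b.2
        (hc.symm.trans (map_zero _).symm)
    exact ⟨hinj, LinearMap.injective_iff_surjective.1 hinj⟩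
  refine ⟨ρ, U, fun X => if h : ∃ j, p X j then h.choose else 0, ?_, ⟨j₀, hρ, hj₀⟩, ?_, ?_⟩
  · change IsOpen[A.toTopologicalSpace] (frameSpan d E ⁻¹' U)
    rwa [hUN]
  · have hU : IsOpen[(grassmannian d E).toTopologicalSpace] U := by
      change IsOpen[A.toTopologicalSpace] (frameSpan d E ⁻¹' U)
      rwa [hUN]
    intro l
    rw [mem_globalFunctions, isRegularOn_sub_iff hU
      (g := fun X => l (if h : ∃ j, p X j then h.choose else 0)) (fun _ _ => rfl)]
    simp only [Set.image_univ, Subtype.range_coe_subtype]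
    -- By definition of the quotient structure, regularity is tested on frames, where the chosen `j`
    -- is the regular family B b ∘ g b.
    change A.IsRegularOn (frameSpan d E ⁻¹' U) _
    have := ((hB.sub N).lcomp hg) l
    rw [mem_globalFunctions, isRegularOn_sub_iff hN
      (g := (fun X => l (if h : ∃ j, p X j then h.choose else 0)) ∘ frameSpan d E)] at this
    · convert this using 1
      rw [hUN]
      simp
    · intro b _
      have h : ∃ j, p (frameSpan d E b) j := ⟨_, hpj b⟩
      rw [Function.comp_apply, dif_pos h, p_unique h.choose_spec (hpj b)]
  · intro X hX
    have h : ∃ j, p X j := hX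
    simp only [h, dif_pos]
    exact h.choose_spec

theorem exists_local_frame {d : ℕ} {φ : X → Gr d E} (hφ : IsMorphism S (grassmannian d E) φ)
    (x₀ : X) : ∃ (N : Set X) (b : X → (Fin d → ℂ) →ₗ[ℂ] E), IsOpen[S.toTopologicalSpace] N ∧
      x₀ ∈ N ∧ (S.sub N).IsRegularMap (fun x => b x) ∧
      ∀ x ∈ N, LinearMap.range (b x) = (φ x).1 := by
  obtain ⟨ρ, U, j, hU, hxU, hj, h⟩ := exists_grassmannian_section (φ x₀)
  refine ⟨φ ⁻¹' U, fun x => j (φ x), hφ.isOpen_preimage hU, hxU, ?_, fun x hx => (h _ hx).2⟩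
  have h1 : IsMorphism (S.sub (φ ⁻¹' U)) ((grassmannian d E).sub U) fun x => ⟨φ x, x.2⟩ :=
    isMorphism_sub_iff.2 (isMorphism_restrict hφ _)
  exact hj.comp h1

/-- The image of a family of subspaces under a regular family of linear maps, enlarged by the
range of another such family. -/
theorem isMorphism_grassmannian_map_sup {d d' : ℕ} {φ : X → Gr d E} {ψ : X → Gr d' F}
    (hφ : IsMorphism S (grassmannian d E) φ) {L : X → E →ₗ[ℂ] F} (hL : S.IsRegularMap L)
    {M : X → G →ₗ[ℂ] F} (hM : S.IsRegularMap M)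
    (h : ∀ x, (ψ x).1 = (φ x).1.map (L x) ⊔ LinearMap.range (M x)) :
    IsMorphism S (grassmannian d' F) ψ := by
  refine isMorphism_of_local fun x₀ => ?_
  obtain ⟨N, b, hN, hx, hb, hbφ⟩ := exists_local_frame hφ x₀
  refine ⟨N, hN, hx, isMorphism_grassmannian_of_range
    (((hL.sub N).lcomp hb).lcoprod (hM.sub N)) fun x => ?_⟩
  rw [LinearMap.range_coprod, LinearMap.range_comp, hbφ x x.2, h]

theorem isMorphism_grassmannian_map {d d' : ℕ} {φ : X → Gr d E} {ψ : X → Gr d' F}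
    (hφ : IsMorphism S (grassmannian d E) φ) {L : X → E →ₗ[ℂ] F} (hL : S.IsRegularMap L)
    (h : ∀ x, (ψ x).1 = (φ x).1.map (L x)) :
    IsMorphism S (grassmannian d' F) ψ :=
  isMorphism_grassmannian_map_sup (G := F) hφ hL (isRegularMap_const 0) (by simpa using h)

end SpaceWithFunctions

/-! ### Local rings, open immersions, and the nonsingularity and irreducibility of affine space. -/

namespace SpaceWithFunctions

variable {X Y : Type*} {S : SpaceWithFunctions X} {T : SpaceWithFunctions Y}

theorem germ_eq_iff {x : X} {f g : X → ℂ} :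
    (f : Filter.Germ (@nhds X S.toTopologicalSpace x) ℂ) = g ↔
      ∃ U, IsOpen[S.toTopologicalSpace] U ∧ x ∈ U ∧ ∀ y ∈ U, f y = g y := by
  let _ := S.toTopologicalSpace
  rw [Filter.Germ.coe_eq]
  refine (eventually_nhds_iff (p := fun y => f y = g y)).trans ⟨?_, ?_⟩
  · rintro ⟨U, h, hU, hx⟩
    exact ⟨U, hU, hx, h⟩
  · rintro ⟨U, hU, hx, h⟩
    exact ⟨U, h, hU, hx⟩

/-- An open immersion: a morphism that is open and induces isomorphisms on local rings. -/
def IsOpenImmersion (S : SpaceWithFunctions X) (T : SpaceWithFunctions Y) (f : X → Y) : Prop :=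
  IsMorphism S T f ∧ ∀ U g, S.IsRegularOn U g → ∃ g', T.IsRegularOn (f '' U) g' ∧
    ∀ x ∈ U, g' (f x) = g x

theorem isOpenImmersion_val {s : Set X} (hs : IsOpen[S.toTopologicalSpace] s) :
    IsOpenImmersion (S.sub s) S Subtype.val := by
  classical
  refine ⟨isMorphism_val s, fun U g hg => ⟨fun x => if h : x ∈ s then g ⟨x, h⟩ else 0, ?_, ?_⟩⟩
  · rwa [← isRegularOn_sub_iff hs]
    intro x _
    simp
  · simp

theorem _root_.IsIsomorphism.isOpenImmersion {e : X ≃ Y} (he : IsIsomorphism S T e) :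
    IsOpenImmersion S T e := by
  refine ⟨he.1, fun U g hg => ⟨g ∘ e.symm, ?_, by simp⟩⟩
  rw [e.image_eq_preimage_symm]
  exact he.2 U g hg

theorem IsOpenImmersion.isOpen_image {f : X → Y} (hf : IsOpenImmersion S T f) {U : Set X}
    (hU : IsOpen[S.toTopologicalSpace] U) : IsOpen[T.toTopologicalSpace] (f '' U) := by
  obtain ⟨g', hg', -⟩ := hf.2 U _ (isRegularOn_const hU 0)
  exact T.isOpen_of_regular hg'

theorem _root_.IsMorphism.tendsto {f : X → Y} (hf : IsMorphism S T f) (x : X) :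
    Filter.Tendsto f (@nhds X S.toTopologicalSpace x) (@nhds Y T.toTopologicalSpace (f x)) := by
  let _ := S.toTopologicalSpace
  let _ := T.toTopologicalSpace
  have : Continuous f := ⟨fun U hU => hf.isOpen_preimage hU⟩
  exact this.tendsto x

/-- Pulling back germs along a morphism. -/
noncomputable def localRingMap {f : X → Y} (hf : IsMorphism S T f) (x : X) :
    T.localRing (f x) →+* S.localRing x where
  toFun a := ⟨a.1.compTendsto f (hf.tendsto x), by
    obtain ⟨_, U, g, hg, hx, rfl⟩ := a
    exact ⟨_, _, hf U g hg, hx, rfl⟩⟩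
  map_one' := rfl
  map_zero' := rfl
  map_mul' := by
    rintro ⟨_, U, g, hg, hx, rfl⟩ ⟨_, V, h, hh, hx', rfl⟩
    rfl
  map_add' := by
    rintro ⟨_, U, g, hg, hx, rfl⟩ ⟨_, V, h, hh, hx', rfl⟩
    rfl

/-- Injectivity uses that the image of a neighbourhood is a neighbourhood; surjectivity uses that
regular functions descend to the image. -/
theorem IsOpenImmersion.bijective_localRingMap {f : X → Y} (hf : IsOpenImmersion S T f) (x : X) :
    Function.Bijective (localRingMap hf.1 x) := by
  constructor
  · rintro ⟨_, U, g, hg, hx, rfl⟩ ⟨_, V, h, hh, hx', rfl⟩ heq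
    refine Subtype.ext (germ_eq_iff.2 ?_)
    obtain ⟨N, hN, hxN, hgh⟩ := germ_eq_iff.1 (congrArg Subtype.val heq)
    refine ⟨f '' N, hf.isOpen_image hN, ⟨x, hxN, rfl⟩, ?_⟩
    rintro _ ⟨y, hy, rfl⟩
    exact hgh y hy
  · rintro ⟨_, U, g, hg, hx, rfl⟩
    obtain ⟨g', hg', h⟩ := hf.2 U g hg
    exact ⟨⟨_, _, g', hg', ⟨x, hx, rfl⟩, rfl⟩, Subtype.ext
      (germ_eq_iff.2 ⟨U, S.isOpen_of_regular hg, hx, h⟩)⟩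

theorem IsOpenImmersion.isRegularLocalRing_iff {f : X → Y} (hf : IsOpenImmersion S T f) (x : X) :
    IsRegularLocalRing (T.localRing (f x)) ↔ IsRegularLocalRing (S.localRing x) := by
  let e := RingEquiv.ofBijective _ (hf.bijective_localRingMap x)
  exact ⟨fun _ => .of_ringEquiv e, fun _ => .of_ringEquiv e.symm⟩

theorem _root_.IsIsomorphism.isNonsingular {e : X ≃ Y} (he : IsIsomorphism S T e)
    (h : T.IsNonsingular) : S.IsNonsingular :=
  fun x => (he.isOpenImmersion.isRegularLocalRing_iff x).1 (h _)

theorem isNonsingular_sub {s : Set X} (hs : IsOpen[S.toTopologicalSpace] s) (h : S.IsNonsingular) :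
    (S.sub s).IsNonsingular :=
  fun x => ((isOpenImmersion_val hs).isRegularLocalRing_iff x).1 (h _)

theorem isNonsingular_of_local (h : ∀ x, ∃ U : Set X, IsOpen[S.toTopologicalSpace] U ∧ x ∈ U ∧
    (S.sub U).IsNonsingular) : S.IsNonsingular := by
  intro x
  obtain ⟨U, hU, hx, hreg⟩ := h x
  exact ((isOpenImmersion_val hU).isRegularLocalRing_iff ⟨x, hx⟩).2 (hreg ⟨x, hx⟩)

section Affine

variable {n : ℕ}

theorem mem_polyFunctions_iff {f : (Fin n → ℂ) → ℂ} : f ∈ polyFunctions (Fin n → ℂ) ↔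
    ∃ p : MvPolynomial (Fin n) ℂ, f = fun x => MvPolynomial.eval x p := by
  constructor
  · intro hf
    induction hf using Algebra.adjoin_induction with
    | mem P hP =>
      obtain ⟨l, rfl⟩ := hP
      refine ⟨∑ i, MvPolynomial.C (l (Pi.single i 1)) * MvPolynomial.X i, ?_⟩
      ext x
      simp only [map_sum, map_mul, MvPolynomial.eval_C, MvPolynomial.eval_X]
      rw [l.pi_apply_eq_sum_univ]
      refine Finset.sum_congr rfl fun i _ => ?_
      rw [smul_eq_mul, mul_comm]
      congr 2
      ext j
      simp [Pi.single_apply, eq_comm]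
    | algebraMap c => exact ⟨MvPolynomial.C c, by ext x; simp⟩
    | add P Q _ _ hP hQ =>
      obtain ⟨p, rfl⟩ := hP
      obtain ⟨q, rfl⟩ := hQ
      exact ⟨p + q, by ext x; simp⟩
    | mul P Q _ _ hP hQ =>
      obtain ⟨p, rfl⟩ := hP
      obtain ⟨q, rfl⟩ := hQ
      exact ⟨p * q, by ext x; simp⟩
  · rintro ⟨p, rfl⟩
    induction p using MvPolynomial.induction_on with
    | C c =>
      simp only [MvPolynomial.eval_C]
      exact Subalgebra.algebraMap_mem (polyFunctions (Fin n → ℂ)) c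
    | add p q hp hq => simpa using! add_mem hp hq
    | mul_X p i hp =>
      simpa using! mul_mem hp (Algebra.subset_adjoin ⟨LinearMap.proj i, rfl⟩)

/-- The germ at `x` of a polynomial. -/
noncomputable def polyGerm (x : Fin n → ℂ) :
    MvPolynomial (Fin n) ℂ →+* (affineSpace (Fin n → ℂ)).localRing x where
  toFun p := ⟨((fun y => MvPolynomial.eval y p : (Fin n → ℂ) → ℂ) : Filter.Germ _ ℂ), Set.univ, _,
    fun y _ => ⟨_, mem_polyFunctions_iff.2 ⟨p, rfl⟩, 1, one_mem _, by simp, fun y _ =>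
      ⟨trivial, by simp⟩⟩, trivial, rfl⟩
  map_one' := Subtype.ext (by simp; rfl)
  map_zero' := Subtype.ext (by simp; rfl)
  map_add' p q := Subtype.ext (by simp; rfl)
  map_mul' p q := Subtype.ext (by simp; rfl)

/-- The local ring at `x` is the localization of the polynomial ring at the kernel of evaluation at
`x`, and localizations of polynomial rings over a field at primes are regular. -/
theorem isRegularLocalRing_affineSpace (x : Fin n → ℂ) :
    IsRegularLocalRing ((affineSpace (Fin n → ℂ)).localRing x) := by
  let P : Ideal (MvPolynomial (Fin n) ℂ) := RingHom.ker (MvPolynomial.eval x)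
  have hP : P.IsPrime := RingHom.ker_isPrime _
  let _ : Algebra (MvPolynomial (Fin n) ℂ) ((affineSpace (Fin n → ℂ)).localRing x) :=
    (polyGerm x).toAlgebra
  have hloc : IsLocalization.AtPrime ((affineSpace (Fin n → ℂ)).localRing x) P := by
    have hreg (q : MvPolynomial (Fin n) ℂ) : (fun y => MvPolynomial.eval y q) ∈
        (affineSpace (Fin n → ℂ)).globalFunctions :=
      isRegularMap_id.poly (mem_polyFunctions_iff.2 ⟨q, rfl⟩)
    refine ⟨?_, ?_, ?_⟩
    · rintro ⟨q, hq : MvPolynomial.eval x q ≠ 0⟩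
      have hO := isOpen_ne_zero (hreg q)
      refine IsUnit.of_mul_eq_one ⟨((fun y => (MvPolynomial.eval y q)⁻¹ : (Fin n → ℂ) → ℂ) :
        Filter.Germ _ ℂ), _, _, (affineSpace (Fin n → ℂ)).inv
          ((affineSpace (Fin n → ℂ)).restrict (hreg q) hO (Set.subset_univ _))
          (fun _ h => h), hq, rfl⟩ ?_
      exact Subtype.ext (germ_eq_iff.2 ⟨_, hO, hq, fun y hy => mul_inv_cancel₀ hy⟩)
    · rintro ⟨_, U, f, hf, hxU, rfl⟩
      obtain ⟨p, hp, q, hq, hqx, hf⟩ := hf x hxU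
      obtain ⟨p, rfl⟩ := mem_polyFunctions_iff.1 hp
      obtain ⟨q, rfl⟩ := mem_polyFunctions_iff.1 hq
      refine ⟨(p, ⟨q, hqx⟩), Subtype.ext (germ_eq_iff.2
        ⟨_, isOpen_ne_zero (hreg q), hqx, fun y hy => ?_⟩)⟩
      change f y * MvPolynomial.eval y q = MvPolynomial.eval y p
      rw [(hf y hy).2, div_mul_cancel₀ _ hy]
    · intro p q hpq
      obtain ⟨U, hU, hxU, h⟩ := germ_eq_iff.1 (congrArg Subtype.val hpq)
      -- If the non-vanishing locus of `r` lies in the set where p = q, then r p and r q agree at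
      -- every point of ℂⁿ, hence as polynomials.
      obtain ⟨r, hr, hrx, hrU⟩ := hU x hxU
      obtain ⟨r, rfl⟩ := mem_polyFunctions_iff.1 hr
      refine ⟨⟨r, hrx⟩, MvPolynomial.funext fun y => ?_⟩
      by_cases hy : MvPolynomial.eval y r = 0
      · simp [hy]
      · simpa using Or.inl (h y (hrU y hy))
  exact .of_ringEquiv (IsLocalization.algEquiv P.primeCompl (Localization.AtPrime P)
    ((affineSpace (Fin n → ℂ)).localRing x)).toRingEquiv

end Affine

theorem isNonsingular_affineSpace {n : ℕ} : (affineSpace (Fin n → ℂ)).IsNonsingular :=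
  isRegularLocalRing_affineSpace

variable {E : Type*} [AddCommGroup E] [Module ℂ E]

theorem isIsomorphism_affineSpace {F : Type*} [AddCommGroup F] [Module ℂ F] (e : E ≃ₗ[ℂ] F) :
    IsIsomorphism (affineSpace E) (affineSpace F) e.toEquiv :=
  ⟨isMorphism_affineSpace_iff.2 (isRegularMap_id.linear e.toLinearMap),
    isMorphism_affineSpace_iff.2 (isRegularMap_id.linear e.symm.toLinearMap)⟩

/-- Non-empty open subsets of an affine space meet. -/
theorem affineSpace_inter_nonempty [FiniteDimensional ℂ E] {U V : Set E}
    (hU : IsOpen[(affineSpace E).toTopologicalSpace] U)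
    (hV : IsOpen[(affineSpace E).toTopologicalSpace] V) (hU' : U.Nonempty) (hV' : V.Nonempty) :
    (U ∩ V).Nonempty := by
  let e : E ≃ₗ[ℂ] (Fin (Module.finrank ℂ E) → ℂ) := LinearEquiv.ofFinrankEq _ _ (by simp)
  have he := (isIsomorphism_affineSpace e).2
  have key {U : Set E} (hU : IsOpen[(affineSpace E).toTopologicalSpace] U) (hU' : U.Nonempty) :
      ∃ q : MvPolynomial (Fin (Module.finrank ℂ E)) ℂ, q ≠ 0 ∧
        ∀ y, MvPolynomial.eval y q ≠ 0 → e.symm y ∈ U := by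
    obtain ⟨x, hx⟩ := hU'
    obtain ⟨q, hq, hqx, hqU⟩ := he.isOpen_preimage hU (e x) (by simpa using! hx)
    obtain ⟨q, rfl⟩ := mem_polyFunctions_iff.1 hq
    exact ⟨q, by rintro rfl; simp at hqx, hqU⟩
  obtain ⟨q, hq, hqU⟩ := key hU hU'
  obtain ⟨r, hr, hrV⟩ := key hV hV'
  -- The polynomial ring is a domain, and a nonzero polynomial over the infinite field ℂ has a
  -- non-zero value.
  obtain ⟨y, hy⟩ : ∃ y, MvPolynomial.eval y (q * r) ≠ 0 := by
    by_contra! h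
    exact mul_ne_zero hq hr (MvPolynomial.funext fun y => by rw [h, map_zero])
  rw [map_mul] at hy
  exact ⟨e.symm y, hqU y (left_ne_zero_of_mul hy), hrV y (right_ne_zero_of_mul hy)⟩

theorem affineSpace_iInter_nonempty [FiniteDimensional ℂ E] {ι : Type*} [Finite ι] {U : ι → Set E}
    (hU : ∀ i, IsOpen[(affineSpace E).toTopologicalSpace] (U i)) (hU' : ∀ i, (U i).Nonempty) :
    (⋂ i, U i).Nonempty := by
  let _ := (affineSpace E).toTopologicalSpace
  have := Fintype.ofFinite ι
  suffices h : ∀ s : Finset ι, IsOpen (⋂ i ∈ s, U i) ∧ (⋂ i ∈ s, U i).Nonempty by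
    simpa using (h Finset.univ).2
  intro s
  refine ⟨isOpen_biInter_finset fun i _ => hU i, ?_⟩
  induction s using Finset.cons_induction with
  | empty => simp
  | cons i s hi ih =>
    simp only [Finset.mem_cons, Set.iInter_iInter_eq_or_left]
    exact affineSpace_inter_nonempty (hU i) (isOpen_biInter_finset fun i _ => hU i) (hU' i) ih

/-- The image of a non-empty open subset of an affine space under a morphism is irreducible. -/
theorem isIrred_of_surjective [FiniteDimensional ℂ E] {O : Set E}
    (hO : IsOpen[(affineSpace E).toTopologicalSpace] O) (hO' : O.Nonempty) {f : O → X}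
    (hf : IsMorphism ((affineSpace E).sub O) S f) (hsurj : Function.Surjective f) :
    S.IsIrred := by
  let _ := S.toTopologicalSpace
  have hX : Nonempty X := ⟨f ⟨_, hO'.some_mem⟩⟩
  have : PreirreducibleSpace X := by
    refine ⟨fun U V hU hV hU' hV' => ?_⟩
    rw [Set.univ_inter] at hU' hV' ⊢
    have key {U : Set X} (hU : IsOpen U) (hU' : U.Nonempty) :
        IsOpen[(affineSpace E).toTopologicalSpace] (Subtype.val '' (f ⁻¹' U)) ∧
          (Subtype.val '' (f ⁻¹' U) : Set E).Nonempty := by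
      refine ⟨isOpen_sub hO (hf.isOpen_preimage hU), ?_⟩
      obtain ⟨x, hx⟩ := hU'
      obtain ⟨y, rfl⟩ := hsurj x
      exact ⟨_, y, hx, rfl⟩
    obtain ⟨_, ⟨y, hy, rfl⟩, ⟨z, hz, hyz⟩⟩ :=
      affineSpace_inter_nonempty (key hU hU').1 (key hV hV').1 (key hU hU').2 (key hV hV').2
    rw [Subtype.ext hyz] at hz
    exact ⟨f y, hy, hz⟩
  exact { toNonempty := hX }

end SpaceWithFunctions

/-! ### Transport of representations and its effect on ranks. -/

section Quiver

set_option linter.unusedSectionVars false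

open SpaceWithFunctions

variable {I₀ I₁ : Type*} [Fintype I₀] [Fintype I₁] {Ω : I₁ → I₀ → Type*} [∀ β α, Fintype (Ω β α)]
variable {X : Type*} {S : SpaceWithFunctions X} {u v w w' : I₀ ⊕ I₁ → ℕ}

section Regular

theorem isRegularMap_repSpace {e : X → RepSpace Ω w w'} : S.IsRegularMap e ↔
    (∀ α, S.IsRegularMap fun x => (e x).1 α) ∧ (∀ β, S.IsRegularMap fun x => (e x).2.1 β) ∧
    ∀ β α h, S.IsRegularMap fun x => (e x).2.2 β α h := by
  simp only [isRegularMap_prod, isRegularMap_pi (f := fun x => (e x).1),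
    isRegularMap_pi (f := fun x => (e x).2.1), isRegularMap_pi (f := fun x => (e x).2.2)]
  refine and_congr_right fun _ => and_congr_right fun _ => forall_congr' fun β => ?_
  rw [isRegularMap_pi]
  exact forall_congr' fun α => isRegularMap_pi

theorem SpaceWithFunctions.IsRegularMap.sinkMap {e : X → RepSpace Ω w w'} (he : S.IsRegularMap e) (α : I₀) :
    S.IsRegularMap fun x => sinkMap (e x) α := by
  rw [isRegularMap_repSpace] at he
  exact (he.1 α).lcoprod (IsRegularMap.sum _ fun h _ =>
    (he.2.2 h.1 α h.2).lcomp (isRegularMap_const _))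

theorem SpaceWithFunctions.IsRegularMap.sourceMap {e : X → RepSpace Ω w w'} (he : S.IsRegularMap e) (β : I₁) :
    S.IsRegularMap fun x => sourceMap (e x) β := by
  rw [isRegularMap_repSpace] at he
  exact (he.2.1 β).lprod (IsRegularMap.lpi fun h => he.2.2 β h.1 h.2)

theorem isOpen_le_vertexRank {e : X → RepSpace Ω w w'} (he : S.IsRegularMap e) (i : I₀ ⊕ I₁)
    (k : ℕ) : IsOpen[S.toTopologicalSpace] {x | k ≤ vertexRank (e x) i} := by
  cases i with
  | inl α => exact isOpen_le_finrank_range (IsRegularMap.sinkMap he α) k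
  | inr β => exact isOpen_le_finrank_range (IsRegularMap.sourceMap he β) k

end Regular

/-- Transport of a representation along maps between the spaces at the vertices. -/
def transport (j : ∀ α : I₀, (Fin (w (.inl α)) → ℂ) →ₗ[ℂ] (Fin (u (.inl α)) → ℂ))
    (q : ∀ β : I₁, (Fin (u (.inr β)) → ℂ) →ₗ[ℂ] (Fin (w (.inr β)) → ℂ))
    (e : RepSpace Ω w w') : RepSpace Ω u w' :=
  (fun α => j α ∘ₗ e.1 α, fun β => e.2.1 β ∘ₗ q β, fun β α h => j α ∘ₗ e.2.2 β α h ∘ₗ q β)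

theorem SpaceWithFunctions.IsRegularMap.transport
    {j : ∀ α : I₀, X → (Fin (w (.inl α)) → ℂ) →ₗ[ℂ] (Fin (u (.inl α)) → ℂ)}
    {q : ∀ β : I₁, X → (Fin (u (.inr β)) → ℂ) →ₗ[ℂ] (Fin (w (.inr β)) → ℂ)}
    {e : X → RepSpace Ω w w'} (hj : ∀ α, S.IsRegularMap (j α)) (hq : ∀ β, S.IsRegularMap (q β))
    (he : S.IsRegularMap e) :
    S.IsRegularMap fun x => transport (fun α => j α x) (fun β => q β x) (e x) := by
  rw [isRegularMap_repSpace] at he ⊢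
  exact ⟨fun α => (hj α).lcomp (he.1 α), fun β => (he.2.1 β).lcomp (hq β),
    fun β α h => (hj α).lcomp ((he.2.2 β α h).lcomp (hq β))⟩

section Transport

variable {j : ∀ α : I₀, (Fin (w (.inl α)) → ℂ) →ₗ[ℂ] (Fin (u (.inl α)) → ℂ)}
    {q : ∀ β : I₁, (Fin (u (.inr β)) → ℂ) →ₗ[ℂ] (Fin (w (.inr β)) → ℂ)}

theorem sinkMap_apply (e : RepSpace Ω w w') (α : I₀) (a) :
    sinkMap e α a = e.1 α a.1 + ∑ h : (Σ β, Ω β α), e.2.2 h.1 α h.2 (a.2 h) := by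
  simp [sinkMap]

theorem sinkMap_transport (e : RepSpace Ω w w') (α : I₀) :
    sinkMap (transport j q e) α = j α ∘ₗ sinkMap e α ∘ₗ
      (LinearMap.id.prodMap (LinearMap.pi fun h => q h.1 ∘ₗ LinearMap.proj h)) := by
  refine LinearMap.ext fun a => ?_
  simp only [LinearMap.comp_apply, sinkMap_apply, transport, map_add, map_sum]
  rfl

theorem sourceMap_transport (e : RepSpace Ω w w') (β : I₁) :
    sourceMap (transport j q e) β =
      (LinearMap.id.prodMap (LinearMap.pi fun h => j h.1 ∘ₗ LinearMap.proj h)) ∘ₗ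
        sourceMap e β ∘ₗ q β :=
  rfl

/-- At a sink A_α is preceded by copies of the q's and followed by j_α; at a source A_β is preceded
by q_β and followed by copies of the j's. The spaces W'_i are untouched, so in both cases a
surjection comes first and an injection last. -/
theorem vertexRank_transport (e : RepSpace Ω w w') (hj : ∀ α, Function.Injective (j α))
    (hq : ∀ β, Function.Surjective (q β)) (i : I₀ ⊕ I₁) :
    vertexRank (transport j q e) i = vertexRank e i := by
  cases i with
  | inl α =>
    have h : Function.Surjective (LinearMap.id.prodMap (LinearMap.pi fun h : (Σ β, Ω β α) =>
        q h.1 ∘ₗ LinearMap.proj h) :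
        ((Fin (w' (.inl α)) → ℂ) × (∀ h : (Σ β, Ω β α), Fin (u (.inr h.1)) → ℂ)) →ₗ[ℂ] _) := by
      rintro ⟨a, b⟩
      choose c hc using fun h : (Σ β, Ω β α) => hq h.1 (b h)
      exact ⟨(a, c), Prod.ext rfl (funext hc)⟩
    simp only [vertexRank]
    rw [sinkMap_transport, LinearMap.range_comp, LinearMap.range_comp,
      LinearMap.range_eq_top.2 h, Submodule.map_top]
    exact (Submodule.equivMapOfInjective _ (hj α) _).symm.finrank_eq
  | inr β =>
    have h : Function.Injective (LinearMap.id.prodMap (LinearMap.pi fun h : (Σ α, Ω β α) =>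
        j h.1 ∘ₗ LinearMap.proj h) :
        ((Fin (w' (.inr β)) → ℂ) × (∀ h : (Σ α, Ω β α), Fin (w (.inl h.1)) → ℂ)) →ₗ[ℂ] _) := by
      rintro ⟨a, b⟩ ⟨a', b'⟩ hab
      simp only [LinearMap.prodMap_apply, Prod.mk.injEq] at hab
      exact Prod.ext hab.1 (funext fun h => hj h.1 (congrFun hab.2 h))
    simp only [vertexRank]
    rw [sourceMap_transport, LinearMap.range_comp, LinearMap.range_comp,
      LinearMap.range_eq_top.2 (hq β), Submodule.map_top]
    exact (Submodule.equivMapOfInjective _ h _).symm.finrank_eq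

/-- Evaluating A_α on vectors supported in one summand, and reading A_β componentwise, shows that π
and θ fix each component. An arrow map is fixed by π at its target and by θ at its source. -/
theorem transport_eq_self {e : RepSpace Ω w w'}
    {π : ∀ α : I₀, (Fin (w (.inl α)) → ℂ) →ₗ[ℂ] (Fin (w (.inl α)) → ℂ)}
    {θ : ∀ β : I₁, (Fin (w (.inr β)) → ℂ) →ₗ[ℂ] (Fin (w (.inr β)) → ℂ)}
    (hπ : ∀ α, π α ∘ₗ sinkMap e α = sinkMap e α)
    (hθ : ∀ β, sourceMap e β ∘ₗ θ β = sourceMap e β) : transport π θ e = e := by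
  classical
  have h1 (α : I₀) (a) : π α (e.1 α a) = e.1 α a := by
    simpa [sinkMap_apply] using LinearMap.congr_fun (hπ α) (a, 0)
  have h2 (α : I₀) (h : Σ β, Ω β α) (b) : π α (e.2.2 h.1 α h.2 b) = e.2.2 h.1 α h.2 b := by
    have hs : ∑ k : (Σ β, Ω β α), e.2.2 k.1 α k.2 (Pi.single (M := fun k : (Σ β, Ω β α) =>
        Fin (w (.inr k.1)) → ℂ) h b k) = e.2.2 h.1 α h.2 b := by
      rw [Finset.sum_eq_single h]
      · simp
      · intro k _ hk; simp [hk]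
      · simp
    have := LinearMap.congr_fun (hπ α) (0, Pi.single h b)
    simp only [LinearMap.comp_apply, sinkMap_apply, map_zero, zero_add] at this
    rwa [hs] at this
  have h3 (β : I₁) (b) : e.2.1 β (θ β b) = e.2.1 β b :=
    congrArg Prod.fst (LinearMap.congr_fun (hθ β) b)
  have h4 (β : I₁) (h : Σ α, Ω β α) (b) : e.2.2 β h.1 h.2 (θ β b) = e.2.2 β h.1 h.2 b :=
    congrFun (congrArg Prod.snd (LinearMap.congr_fun (hθ β) b)) h
  refine Prod.ext ?_ (Prod.ext ?_ ?_)
  · exact funext fun α => LinearMap.ext fun a => h1 α a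
  · exact funext fun β => LinearMap.ext fun a => h3 β a
  · refine funext fun β => funext fun α => funext fun h => LinearMap.ext fun a => ?_
    exact (h2 α ⟨β, h⟩ _).trans (h4 β ⟨α, h⟩ a)

end Transport

section Rank

variable {E F : Type*} [AddCommGroup E] [Module ℂ E] [FiniteDimensional ℂ E]
  [AddCommGroup F] [Module ℂ F] [FiniteDimensional ℂ F]

/-- Every linear map of rank `k` factors through `ℂᵏ`: its range is that of a split
monomorphism. -/
theorem exists_range_eq {k : ℕ} (V : Submodule ℂ E) (hV : Module.finrank ℂ V = k) :
    ∃ (j : (Fin k → ℂ) →ₗ[ℂ] E) (ρ : E →ₗ[ℂ] (Fin k → ℂ)),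
      ρ ∘ₗ j = LinearMap.id ∧ LinearMap.range j = V := by
  let j : (Fin k → ℂ) →ₗ[ℂ] E :=
    V.subtype ∘ₗ (LinearEquiv.ofFinrankEq (Fin k → ℂ) V (by simp [hV])).toLinearMap
  obtain ⟨ρ, hρ⟩ := j.exists_leftInverse_of_injective (by
    rw [LinearMap.ker_eq_bot]
    exact V.subtype_injective.comp (LinearEquiv.injective _))
  exact ⟨j, ρ, hρ, by simp [j, LinearMap.range_comp]⟩

/-- Dual to the preceding lemma: identify the range of A with ℂᵏ, so that A becomes a split
surjection with the same kernel. -/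
theorem exists_ker_eq {k : ℕ} (A : E →ₗ[ℂ] F) (hA : Module.finrank ℂ (LinearMap.range A) = k) :
    ∃ (q : E →ₗ[ℂ] (Fin k → ℂ)) (σ : (Fin k → ℂ) →ₗ[ℂ] E),
      q ∘ₗ σ = LinearMap.id ∧ LinearMap.ker q = LinearMap.ker A := by
  let e := LinearEquiv.ofFinrankEq (LinearMap.range A) (Fin k → ℂ) (by rw [hA, Module.finrank_fin_fun])
  let q : E →ₗ[ℂ] (Fin k → ℂ) := e.toLinearMap ∘ₗ A.rangeRestrict
  obtain ⟨σ, hσ⟩ := q.exists_rightInverse_of_surjective (by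
    rw [LinearMap.range_eq_top]
    exact e.surjective.comp A.surjective_rangeRestrict)
  refine ⟨q, σ, hσ, ?_⟩
  rw [LinearEquiv.ker_comp, LinearMap.ker_rangeRestrict]

theorem exists_comp_eq_id {k l : ℕ} (h : k ≤ l) :
    ∃ (j : (Fin k → ℂ) →ₗ[ℂ] (Fin l → ℂ)) (ρ : (Fin l → ℂ) →ₗ[ℂ] (Fin k → ℂ)),
      ρ ∘ₗ j = LinearMap.id := by
  obtain ⟨j, ρ, h⟩ := exists_bijective_of_le_finrank_range
    (A := (LinearMap.id : (Fin l → ℂ) →ₗ[ℂ] _)) (k := k) (by rwa [LinearMap.range_id, finrank_top, Module.finrank_fin_fun])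
  exact ⟨j, ρ, h⟩

theorem comp_comp_eq_of_range_le {k : ℕ} {A : E →ₗ[ℂ] F} {j : (Fin k → ℂ) →ₗ[ℂ] F}
    {ρ : F →ₗ[ℂ] (Fin k → ℂ)} (h : ρ ∘ₗ j = LinearMap.id)
    (hA : LinearMap.range A ≤ LinearMap.range j) : (j ∘ₗ ρ) ∘ₗ A = A := by
  ext x
  obtain ⟨y, hy⟩ := hA ⟨x, rfl⟩
  simp only [LinearMap.comp_apply, ← hy]
  rw [show ρ (j y) = y from LinearMap.congr_fun h y]

/-- The map σ ∘ q differs from the identity only by vectors in ker q, which A kills. -/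
theorem comp_comp_eq_of_ker_le {k : ℕ} {A : E →ₗ[ℂ] F} {q : E →ₗ[ℂ] (Fin k → ℂ)}
    {σ : (Fin k → ℂ) →ₗ[ℂ] E} (h : q ∘ₗ σ = LinearMap.id)
    (hA : LinearMap.ker q ≤ LinearMap.ker A) : A ∘ₗ (σ ∘ₗ q) = A := by
  ext x
  have : σ (q x) - x ∈ LinearMap.ker A := hA (by
    rw [LinearMap.mem_ker, map_sub, show q (σ (q x)) = q x from LinearMap.congr_fun h _, sub_self])
  rw [LinearMap.mem_ker, map_sub, sub_eq_zero] at this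
  exact this

end Rank

/-! ### The role of l-dominance: nonemptiness and irreducibility of the strata. -/

theorem finrank_sink (α : I₀) : Module.finrank ℂ
    ((Fin (w' (.inl α)) → ℂ) × (∀ h : (Σ β, Ω β α), Fin (w (.inr h.1)) → ℂ)) =
      w' (.inl α) + ∑ h : (Σ β, Ω β α), w (.inr h.1) := by
  simp [Module.finrank_pi_fintype]

theorem finrank_source (β : I₁) : Module.finrank ℂ
    ((Fin (w' (.inr β)) → ℂ) × (∀ h : (Σ α, Ω β α), Fin (w (.inl h.1)) → ℂ)) =
      w' (.inr β) + ∑ h : (Σ α, Ω β α), w (.inl h.1) := by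
  simp [Module.finrank_pi_fintype]

/-- This form avoids subtraction: after replacing `w` by `u`, the right-hand sides are the
dimensions of the source of A_α and of the target of A_β. -/
theorem lDominant_iff : LDominant Ω u w w' ↔
    (∀ i, u i ≤ w i) ∧ (∀ α, u (.inl α) ≤ w' (.inl α) + ∑ h : (Σ β, Ω β α), u (.inr h.1)) ∧
    ∀ β, u (.inr β) ≤ w' (.inr β) + ∑ h : (Σ α, Ω β α), u (.inl h.1) := by
  simp only [LDominant, forall_and, Sum.forall, adjacentSum]
  constructor
  · rintro ⟨⟨h1, h2⟩, h3, h4⟩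
    refine ⟨⟨fun i => by exact_mod_cast h1 i, fun i => by exact_mod_cast h2 i⟩, fun α => ?_,
      fun β => ?_⟩
    · have := h3 α; zify; push_cast at this; linarith
    · have := h4 β; zify; push_cast at this; linarith
  · rintro ⟨⟨h1, h2⟩, h3, h4⟩
    refine ⟨⟨fun i => by exact_mod_cast h1 i, fun i => by exact_mod_cast h2 i⟩, fun α => ?_,
      fun β => ?_⟩
    · have := h3 α; zify at this; push_cast; linarith
    · have := h4 β; zify at this; push_cast; linarith

/-- A representation comes from one on spaces whose dimensions are the ranks. -/
theorem exists_transport_eq (e : RepSpace Ω w w') (he : ∀ i, vertexRank e i = u i) :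
    ∃ (j : ∀ α : I₀, (Fin (u (.inl α)) → ℂ) →ₗ[ℂ] (Fin (w (.inl α)) → ℂ))
      (q : ∀ β : I₁, (Fin (w (.inr β)) → ℂ) →ₗ[ℂ] (Fin (u (.inr β)) → ℂ))
      (e' : RepSpace Ω u w'), (∀ α, Function.Injective (j α)) ∧
      (∀ β, Function.Surjective (q β)) ∧ transport j q e' = e := by
  -- Here j ∘ ρ projects onto im A_α, and below σ ∘ q is the identity modulo ker A_β. Transport
  -- along these projectors fixes `e`, and splitting them exhibits the smaller representation.
  choose j ρ hρj hj using fun α => exists_range_eq (LinearMap.range (sinkMap e α)) (he (.inl α))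
  choose q σ hqσ hq using fun β => exists_ker_eq (sourceMap e β) (he (.inr β))
  refine ⟨j, q, transport ρ σ e, fun α => ?_, fun β => ?_, ?_⟩
  · exact Function.LeftInverse.injective (g := ρ α) (LinearMap.congr_fun (hρj α))
  · exact Function.RightInverse.surjective (g := σ β) (LinearMap.congr_fun (hqσ β))
  · exact transport_eq_self (fun α => comp_comp_eq_of_range_le (hρj α) (hj α).ge)
      fun β => comp_comp_eq_of_ker_le (hqσ β) (hq β).le

theorem vertexRank_le (e : RepSpace Ω w w') (i : I₀ ⊕ I₁) : vertexRank e i ≤ w i := by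
  rcases i with α | β
  · exact (LinearMap.range (sinkMap e α)).finrank_le.trans_eq (Module.finrank_fin_fun ℂ)
  · exact (LinearMap.finrank_range_le (sourceMap e β)).trans_eq (Module.finrank_fin_fun ℂ)

/-- The reduced representation has the same ranks, and its maps A_i live on spaces of dimensions
`u`; the source of A_α and the target of A_β bound the ranks. -/
theorem lDominant_vertexRank (e : RepSpace Ω w w') : LDominant Ω (vertexRank e) w w' := by
  obtain ⟨j, q, e', hj, hq, he⟩ := exists_transport_eq e fun _ => rfl
  have he' := vertexRank_transport e' hj hq
  rw [he] at he'
  refine lDominant_iff.2 ⟨vertexRank_le _, fun α => ?_, fun β => ?_⟩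
  · exact (he' _).trans_le ((LinearMap.finrank_range_le (sinkMap e' α)).trans_eq (finrank_sink α))
  · exact (he' _).trans_le ((Submodule.finrank_le _).trans_eq (finrank_source β))

theorem isOpen_le_vertexRank_all (k : I₀ ⊕ I₁ → ℕ) {e : X → RepSpace Ω w w'}
    (he : S.IsRegularMap e) : IsOpen[S.toTopologicalSpace] {x | ∀ i, k i ≤ vertexRank (e x) i} := by
  let _ := S.toTopologicalSpace
  simp only [Set.ofPred_forall]
  exact isOpen_iInter_of_finite fun i => isOpen_le_vertexRank he i _

/-- If `(u, w)` is `l`-dominant, then the generic representation on spaces of dimensions `u` has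
ranks `u`. -/
theorem exists_vertexRank_eq (h : LDominant Ω u w w') :
    ∃ e : RepSpace Ω u w', ∀ i, u i ≤ vertexRank e i := by
  classical
  obtain ⟨-, h₀, h₁⟩ := lDominant_iff.1 h
  have hU := fun i => isOpen_le_vertexRank (isRegularMap_id (E := RepSpace Ω u w')) i (u i)
  -- The rank conditions are open in an irreducible space, so they need to be realized at one vertex
  -- at a time only.
  refine (affineSpace_iInter_nonempty hU ?_).imp fun e he i => Set.mem_iInter.1 he i
  rintro (α | β)
  -- At a sink, dominance allows a surjection T, and the components of `e` are read off as the
  -- restrictions of T to the summands.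
  · have key (α : I₀) : ∃ T : ((Fin (w' (.inl α)) → ℂ) × (∀ h : (Σ β, Ω β α),
        Fin (u (.inr h.1)) → ℂ)) →ₗ[ℂ] (Fin (u (.inl α)) → ℂ), Function.Surjective T := by
      obtain ⟨r, ρ, hρ⟩ := exists_bijective_of_le_finrank_range (A := (LinearMap.id :
        ((Fin (w' (.inl α)) → ℂ) × (∀ h : (Σ β, Ω β α), Fin (u (.inr h.1)) → ℂ)) →ₗ[ℂ] _))
        (k := u (.inl α)) (by rw [LinearMap.range_id, finrank_top, finrank_sink]; exact h₀ α)
      exact ⟨ρ, Function.RightInverse.surjective (g := r) (LinearMap.congr_fun hρ)⟩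
    choose T hT using key
    refine ⟨(fun α => T α ∘ₗ LinearMap.inl ℂ _ _, 0, fun β α h => T α ∘ₗ LinearMap.inr ℂ _ _ ∘ₗ
      LinearMap.single ℂ (fun h : (Σ β, Ω β α) => Fin (u (.inr h.1)) → ℂ) ⟨β, h⟩), ?_⟩
    refine ((Module.finrank_fin_fun ℂ).symm.trans (finrank_top ℂ _).symm).trans_le ?_
    rw [← LinearMap.range_eq_top.2 (hT α)]
    refine (congrArg (fun A => Module.finrank ℂ (LinearMap.range A)) ?_).le
    refine LinearMap.prod_ext ?_ (LinearMap.pi_ext' fun h => ?_)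
    · ext1 i
      refine LinearMap.ext fun c => ?_
      simp [sinkMap_apply, Prod.mk_zero_zero]
    · refine LinearMap.ext fun c => ?_
      simp only [LinearMap.comp_apply, sinkMap_apply, LinearMap.inr_apply, map_zero, zero_add]
      rw [Finset.sum_eq_single h]
      · simp
      · intro k _ hk; simp [hk, Prod.mk_zero_zero]
      · simp
  -- At a source, dominance allows an injection T, whose coordinates are the components of `e`.
  · have key (β : I₁) : ∃ T : (Fin (u (.inr β)) → ℂ) →ₗ[ℂ] ((Fin (w' (.inr β)) → ℂ) ×
        (∀ h : (Σ α, Ω β α), Fin (u (.inl h.1)) → ℂ)), Function.Injective T := by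
      obtain ⟨r, ρ, hρ⟩ := exists_bijective_of_le_finrank_range (A := (LinearMap.id :
        ((Fin (w' (.inr β)) → ℂ) × (∀ h : (Σ α, Ω β α), Fin (u (.inl h.1)) → ℂ)) →ₗ[ℂ] _))
        (k := u (.inr β)) (by rw [LinearMap.range_id, finrank_top, finrank_source]; exact h₁ β)
      exact ⟨r, Function.LeftInverse.injective (g := ρ) (LinearMap.congr_fun hρ)⟩
    choose T hT using key
    refine ⟨(0, fun β => LinearMap.fst ℂ _ _ ∘ₗ T β, fun β α h =>
      LinearMap.proj (⟨α, h⟩ : Σ α, Ω β α) ∘ₗ LinearMap.snd ℂ _ _ ∘ₗ T β), ?_⟩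
    exact ((Module.finrank_fin_fun ℂ).symm.trans (LinearMap.finrank_range_of_inj (hT β)).symm).le

/-- For existence, a generic representation on spaces of dimensions `u` is transported along
injections ℂ^u → ℂ^w at the sinks and surjections ℂ^w → ℂ^u at the sources. -/
theorem stratum_nonempty_iff : (stratum Ω u w w').Nonempty ↔ LDominant Ω u w w' := by
  constructor
  · rintro ⟨e, he⟩
    rw [← show vertexRank e = u from funext he]
    exact lDominant_vertexRank e
  · intro h
    obtain ⟨e, he⟩ := exists_vertexRank_eq h
    choose j ρ hj using fun α => exists_comp_eq_id ((lDominant_iff.1 h).1 (.inl α))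
    choose σ q hq using fun β => exists_comp_eq_id ((lDominant_iff.1 h).1 (.inr β))
    refine ⟨transport j q e, fun i => ?_⟩
    rw [vertexRank_transport]
    · exact (vertexRank_le e i).antisymm (he i)
    · exact fun α => Function.LeftInverse.injective (g := ρ α) (LinearMap.congr_fun (hj α))
    · exact fun β => Function.RightInverse.surjective (g := σ β) (LinearMap.congr_fun (hq β))

theorem le_finrank_range_iff_injective {k : ℕ} {E : Type*} [AddCommGroup E] [Module ℂ E]
    [FiniteDimensional ℂ E] (j : (Fin k → ℂ) →ₗ[ℂ] E) :
    k ≤ Module.finrank ℂ (LinearMap.range j) ↔ Function.Injective j := by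
  have := LinearMap.finrank_range_add_finrank_ker j
  rw [Module.finrank_fin_fun] at this
  rw [← LinearMap.ker_eq_bot, ← Submodule.finrank_eq_zero]
  omega

theorem le_finrank_range_iff_surjective {k : ℕ} {E : Type*} [AddCommGroup E] [Module ℂ E]
    [FiniteDimensional ℂ E] (q : E →ₗ[ℂ] (Fin k → ℂ)) :
    k ≤ Module.finrank ℂ (LinearMap.range q) ↔ Function.Surjective q := by
  rw [← LinearMap.range_eq_top]
  constructor
  · intro h
    refine Submodule.eq_top_of_finrank_eq (le_antisymm (Submodule.finrank_le _) ?_)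
    rwa [Module.finrank_fin_fun]
  · intro h
    rw [h, finrank_top, Module.finrank_fin_fun]

/-- Transport maps an open subset of an affine space onto the stratum: the triples of a
representation of maximal ranks, injections at the sinks and surjections at the sources. -/
theorem isIrred_stratum (h : LDominant Ω u w w') :
    ((repSpace Ω w w').sub (stratum Ω u w w')).IsIrred := by
  let P := RepSpace Ω u w' × (∀ α : I₀, (Fin (u (.inl α)) → ℂ) →ₗ[ℂ] (Fin (w (.inl α)) → ℂ)) ×
    (∀ β : I₁, (Fin (w (.inr β)) → ℂ) →ₗ[ℂ] (Fin (u (.inr β)) → ℂ))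
  have hid : (affineSpace P).IsRegularMap fun p : P => p := isRegularMap_id
  have he : (affineSpace P).IsRegularMap fun p : P => p.1 := (isRegularMap_prod.1 hid).1
  have hj (α : I₀) : (affineSpace P).IsRegularMap fun p : P => p.2.1 α :=
    isRegularMap_pi.1 (isRegularMap_prod.1 (isRegularMap_prod.1 hid).2).1 α
  have hq (β : I₁) : (affineSpace P).IsRegularMap fun p : P => p.2.2 β :=
    isRegularMap_pi.1 (isRegularMap_prod.1 (isRegularMap_prod.1 hid).2).2 β
  let O : Set P := {p | ∀ i, u i ≤ vertexRank p.1 i} ∩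
    ((⋂ α, {p | u (.inl α) ≤ Module.finrank ℂ (LinearMap.range (p.2.1 α))}) ∩
      ⋂ β, {p | u (.inr β) ≤ Module.finrank ℂ (LinearMap.range (p.2.2 β))})
  have hO : IsOpen[(affineSpace P).toTopologicalSpace] O := by
    let _ := (affineSpace P).toTopologicalSpace
    exact (isOpen_le_vertexRank_all u he).inter
      ((isOpen_iInter_of_finite fun α => isOpen_le_finrank_range (hj α) _).inter
        (isOpen_iInter_of_finite fun β => isOpen_le_finrank_range (hq β) _))
  have hmem (p : P) : p ∈ O ↔ (∀ i, u i ≤ vertexRank p.1 i) ∧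
      (∀ α, Function.Injective (p.2.1 α)) ∧ ∀ β, Function.Surjective (p.2.2 β) := by
    simp only [← le_finrank_range_iff_injective, ← le_finrank_range_iff_surjective]
    simp [O]
  have hstr (p : O) : transport p.1.2.1 p.1.2.2 p.1.1 ∈ stratum Ω u w w' := fun i => by
    obtain ⟨h1, h2, h3⟩ := (hmem _).1 p.2
    rw [vertexRank_transport _ h2 h3]
    exact (vertexRank_le _ i).antisymm (h1 i)
  let f (p : O) : stratum Ω u w w' := ⟨transport p.1.2.1 p.1.2.2 p.1.1, hstr p⟩
  have hf : IsMorphism ((affineSpace P).sub O) ((repSpace Ω w w').sub (stratum Ω u w w')) f :=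
    isMorphism_sub_iff.2 (isMorphism_affineSpace_iff.2
      ((IsRegularMap.transport hj hq he).sub O))
  have hsurj : Function.Surjective f := by
    rintro ⟨e, he⟩
    obtain ⟨j, q, e', hj, hq, rfl⟩ := exists_transport_eq e he
    refine ⟨⟨(e', j, q), (hmem _).2 ⟨fun i => ?_, hj, hq⟩⟩, rfl⟩
    rw [← he i, vertexRank_transport _ hj hq]
  refine isIrred_of_surjective hO ?_ hf hsurj
  obtain ⟨e, he⟩ := stratum_nonempty_iff.2 h
  obtain ⟨p, -⟩ := hsurj ⟨e, he⟩
  exact ⟨p, p.2⟩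

end Quiver

/-! ### Charts, and what they imply for nonsingularity and rationality. -/

namespace SpaceWithFunctions

variable {X Y Z : Type*} {S : SpaceWithFunctions X} {T : SpaceWithFunctions Y}
  {R : SpaceWithFunctions Z}

theorem isRegularMap_submodule {E : Type*} [AddCommGroup E] [Module ℂ E] {p : Submodule ℂ E}
    {f : X → p} : S.IsRegularMap f ↔ S.IsRegularMap fun x => (f x : E) := by
  refine ⟨fun h => h.linear p.subtype, fun h l => ?_⟩
  obtain ⟨l', rfl⟩ := l.exists_extend
  exact h l'

theorem _root_.IsIsomorphism.trans {e : X ≃ Y} {e' : Y ≃ Z} (he : IsIsomorphism S T e)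
    (he' : IsIsomorphism T R e') : IsIsomorphism S R (e.trans e') :=
  ⟨he'.1.comp he.1, he.2.comp he'.2⟩

/-- `S` has a chart at `x`: an open neighbourhood that is isomorphic to an open subset of an affine
space. -/
def HasChartAt (S : SpaceWithFunctions X) (x : X) : Prop :=
  ∃ (m : ℕ) (U : Set X) (V : Set (Fin m → ℂ)), IsOpen[S.toTopologicalSpace] U ∧ x ∈ U ∧
    IsOpen[(affineSpace (Fin m → ℂ)).toTopologicalSpace] V ∧
    ∃ e : U ≃ V, IsIsomorphism (S.sub U) ((affineSpace (Fin m → ℂ)).sub V) e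

theorem hasChartAt_of_finiteDimensional {E : Type*} [AddCommGroup E] [Module ℂ E]
    [FiniteDimensional ℂ E] {x : X} {U : Set X} {V : Set E}
    (hU : IsOpen[S.toTopologicalSpace] U) (hx : x ∈ U)
    (hV : IsOpen[(affineSpace E).toTopologicalSpace] V) (e : U ≃ V)
    (he : IsIsomorphism (S.sub U) ((affineSpace E).sub V) e) : S.HasChartAt x := by
  let L : E ≃ₗ[ℂ] (Fin (Module.finrank ℂ E) → ℂ) := LinearEquiv.ofFinrankEq _ _ (by simp)
  have hL := isIsomorphism_affineSpace L
  refine ⟨_, U, L.toEquiv '' V, hU, hx, ?_, e.trans (L.toEquiv.image V), he.trans ⟨?_, ?_⟩⟩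
  · rw [L.toEquiv.image_eq_preimage_symm]
    exact hL.2.isOpen_preimage hV
  · exact isMorphism_sub_iff.2 (isMorphism_restrict hL.1 V)
  · refine isMorphism_sub_iff.2 ?_
    convert isMorphism_restrict hL.2 (L.toEquiv '' V) using 2 with x
    obtain ⟨_, y, hy, rfl⟩ := x
    exact (congrArg Subtype.val ((L.toEquiv.image V).symm_apply_apply ⟨y, hy⟩)).trans
      (L.toEquiv.symm_apply_apply y).symm

theorem isNonsingular_of_hasChartAt (h : ∀ x, S.HasChartAt x) : S.IsNonsingular := by
  refine isNonsingular_of_local fun x => ?_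
  obtain ⟨m, U, V, hU, hx, hV, e, he⟩ := h x
  exact ⟨U, hU, hx, he.isNonsingular (isNonsingular_sub hV isNonsingular_affineSpace)⟩

theorem IsIrred.isRational (hS : S.IsIrred) (h : ∀ x, S.HasChartAt x) : S.IsRational := by
  refine ⟨hS, ?_⟩
  let _ := S.toTopologicalSpace
  obtain ⟨x⟩ := hS.toNonempty
  obtain ⟨m, U, V, hU, hx, hV, e, he⟩ := h x
  exact ⟨m, U, V, hU, ⟨x, hx⟩, hV, ⟨_, (e ⟨x, hx⟩).2⟩, e, he⟩

end SpaceWithFunctions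

/-! ### Linear model spaces for the charts. -/

section Hom

variable {E F : Type*} (G : Type*) [AddCommGroup E] [Module ℂ E] [AddCommGroup F] [Module ℂ F]
  [AddCommGroup G] [Module ℂ G]

/-- The linear maps `G → E` with values in the kernel of `ρ : E → F`. -/
def homIntoKer (ρ : E →ₗ[ℂ] F) : Submodule ℂ (G →ₗ[ℂ] E) where
  carrier := {k | ρ ∘ₗ k = 0}
  zero_mem' := LinearMap.comp_zero ρ
  add_mem' {a b} (ha : ρ ∘ₗ a = 0) (hb : ρ ∘ₗ b = 0) := by
    simp [LinearMap.comp_add, ha, hb]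
  smul_mem' c a (ha : ρ ∘ₗ a = 0) := by simp [LinearMap.comp_smul, ha]

/-- The linear maps `E → G` that vanish on the range of `σ : F → E`. -/
def homVanishingOnRange (σ : F →ₗ[ℂ] E) : Submodule ℂ (E →ₗ[ℂ] G) where
  carrier := {k | k ∘ₗ σ = 0}
  zero_mem' := LinearMap.zero_comp σ
  add_mem' {a b} (ha : a ∘ₗ σ = 0) (hb : b ∘ₗ σ = 0) := by
    simp [LinearMap.add_comp, ha, hb]
  smul_mem' c a (ha : a ∘ₗ σ = 0) := by simp [LinearMap.smul_comp, ha]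

end Hom

section Quiver

open SpaceWithFunctions

variable {I₀ I₁ : Type*} [Fintype I₀] [Fintype I₁] {Ω : I₁ → I₀ → Type*} [∀ β α, Fintype (Ω β α)]
variable {u v w w' : I₀ ⊕ I₁ → ℕ}

/-- Near e₀ each representation in the stratum is the transport of a unique triple (e', j, q) with ρ
∘ j = id and q ∘ σ = id, where ρ and σ are constant. These normalizations are affine-linear in j and
q, so the triples form an affine space, and the chart is the open part of it lying over `good`. -/
theorem hasChartAt_stratum (e₀ : stratum Ω u w w') :
    ((repSpace Ω w w').sub (stratum Ω u w w')).HasChartAt e₀ := by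
  choose r ρ hρ using fun α => exists_bijective_of_le_finrank_range (e₀.2 (.inl α)).ge
  choose σ l hl using fun β => exists_bijective_of_le_finrank_range (e₀.2 (.inr β)).ge
  let T := (repSpace Ω w w').sub (stratum Ω u w w')
  let good : Set (RepSpace Ω w w') := (⋂ α, {e | Function.Bijective (ρ α ∘ₗ sinkMap e α ∘ₗ r α)}) ∩
    ⋂ β, {e | Function.Bijective (l β ∘ₗ sourceMap e β ∘ₗ σ β)}
  have hgood : IsOpen[(repSpace Ω w w').toTopologicalSpace] good := by
    let _ := (repSpace Ω w w').toTopologicalSpace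
    exact (isOpen_iInter_of_finite fun α => isOpen_bijective ((isRegularMap_const _).lcomp
        ((IsRegularMap.sinkMap isRegularMap_id α).lcomp (isRegularMap_const _)))).inter
      (isOpen_iInter_of_finite fun β => isOpen_bijective ((isRegularMap_const _).lcomp
        ((IsRegularMap.sourceMap isRegularMap_id β).lcomp (isRegularMap_const _))))
  have hmem₀ {e} (he : e ∈ good) (α : I₀) : Function.Bijective (ρ α ∘ₗ sinkMap e α ∘ₗ r α) :=
    Set.mem_iInter.1 he.1 α
  have hmem₁ {e} (he : e ∈ good) (β : I₁) : Function.Bijective (l β ∘ₗ sourceMap e β ∘ₗ σ β) :=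
    Set.mem_iInter.1 he.2 β
  have hrank {e : RepSpace Ω w w'} (he : e ∈ good) (i : I₀ ⊕ I₁) : u i ≤ vertexRank e i := by
    rcases i with α | β
    · exact le_finrank_range_of_bijective (hmem₀ he α)
    · exact le_finrank_range_of_bijective (hmem₁ he β)
  let U : Set (stratum Ω u w w') := Subtype.val ⁻¹' good
  have hU : IsOpen[T.toTopologicalSpace] U := (isMorphism_val _).isOpen_preimage hgood
  have hx₀ : e₀ ∈ U := by
    refine ⟨Set.mem_iInter.2 fun α => ?_, Set.mem_iInter.2 fun β => ?_⟩
    · simp only [Set.mem_ofPred_eq, hρ]; exact Function.bijective_id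
    · simp only [Set.mem_ofPred_eq, hl]; exact Function.bijective_id
  have hid : (T.sub U).IsRegularMap fun x => (x : RepSpace Ω w w') :=
    ((isRegularMap_id (E := RepSpace Ω w w')).sub _).sub _
  have hA₀ (α : I₀) : (T.sub U).IsRegularMap fun x => sinkMap x.1.1 α :=
    IsRegularMap.sinkMap hid α
  have hA₁ (β : I₁) : (T.sub U).IsRegularMap fun x => sourceMap x.1.1 β :=
    IsRegularMap.sourceMap hid β
  choose g₀ hg₀ hg₀' using fun α => IsRegularMap.exists_inverse
    ((isRegularMap_const (ρ α)).lcomp ((hA₀ α).lcomp (isRegularMap_const (r α))))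
    fun x => hmem₀ x.2 α
  choose g₁ hg₁ hg₁' using fun β => IsRegularMap.exists_inverse
    ((isRegularMap_const (l β)).lcomp ((hA₁ β).lcomp (isRegularMap_const (σ β))))
    fun x => hmem₁ x.2 β
  -- J is the frame A r (ρ A r)⁻¹ of im A_α, and Q below is the coordinate map (l A σ)⁻¹ l A on W_β
  -- modulo ker A_β; both are regular in the representation.
  let J (α : I₀) (x : U) := sinkMap x.1.1 α ∘ₗ r α ∘ₗ g₀ α x
  let Q (β : I₁) (x : U) := g₁ β x ∘ₗ l β ∘ₗ sourceMap x.1.1 β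
  have hJ (α : I₀) : (T.sub U).IsRegularMap (J α) :=
    (hA₀ α).lcomp ((isRegularMap_const _).lcomp (hg₀ α))
  have hQ (β : I₁) : (T.sub U).IsRegularMap (Q β) :=
    (hg₁ β).lcomp ((isRegularMap_const _).lcomp (hA₁ β))
  have hρJ (α : I₀) (x : U) : ρ α ∘ₗ J α x = LinearMap.id := (hg₀' α x).2
  have hQσ (β : I₁) (x : U) : Q β x ∘ₗ σ β = LinearMap.id := (hg₁' β x).1
  let j₀ (α : I₀) := sinkMap e₀.1 α ∘ₗ r α
  let q₀ (β : I₁) := l β ∘ₗ sourceMap e₀.1 β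
  -- Subtracting the values j₀ and q₀ at the base point turns the normalizations into linear
  -- conditions.
  let K (α : I₀) := homIntoKer (Fin (u (.inl α)) → ℂ) (ρ α)
  let L (β : I₁) := homVanishingOnRange (Fin (u (.inr β)) → ℂ) (σ β)
  let P := RepSpace Ω u w' × (∀ α, K α) × (∀ β, L β)
  have hPid : (affineSpace P).IsRegularMap fun p : P => p := isRegularMap_id
  have hPj (α : I₀) : (affineSpace P).IsRegularMap fun p : P => j₀ α + (p.2.1 α).1 :=
    (isRegularMap_const _).add (isRegularMap_submodule.1
      (isRegularMap_pi.1 (isRegularMap_prod.1 (isRegularMap_prod.1 hPid).2).1 α))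
  have hPq (β : I₁) : (affineSpace P).IsRegularMap fun p : P => q₀ β + (p.2.2 β).1 :=
    (isRegularMap_const _).add (isRegularMap_submodule.1
      (isRegularMap_pi.1 (isRegularMap_prod.1 (isRegularMap_prod.1 hPid).2).2 β))
  let Φ (p : P) : RepSpace Ω w w' :=
    transport (fun α => j₀ α + (p.2.1 α).1) (fun β => q₀ β + (p.2.2 β).1) p.1
  have hΦ : (affineSpace P).IsRegularMap Φ :=
    IsRegularMap.transport hPj hPq (isRegularMap_prod.1 hPid).1
  have hρj (p : P) (α : I₀) : ρ α ∘ₗ (j₀ α + (p.2.1 α).1) = LinearMap.id := by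
    rw [LinearMap.comp_add, show ρ α ∘ₗ (p.2.1 α).1 = 0 from (p.2.1 α).2, add_zero]
    exact hρ α
  have hqσ (p : P) (β : I₁) : (q₀ β + (p.2.2 β).1) ∘ₗ σ β = LinearMap.id := by
    rw [LinearMap.add_comp, show (p.2.2 β).1 ∘ₗ σ β = 0 from (p.2.2 β).2, add_zero]
    exact hl β
  let V : Set P := Φ ⁻¹' good
  have hV : IsOpen[(affineSpace P).toTopologicalSpace] V :=
    (isMorphism_affineSpace_iff.2 hΦ).isOpen_preimage hgood
  have hΦV (p : V) : Φ p ∈ stratum Ω u w w' := fun i => by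
    refine le_antisymm ?_ (hrank p.2 i)
    rw [vertexRank_transport]
    · exact vertexRank_le _ i
    · exact fun α => Function.LeftInverse.injective (g := ρ α) (LinearMap.congr_fun (hρj p α))
    · exact fun β => Function.RightInverse.surjective (g := σ β) (LinearMap.congr_fun (hqσ p β))
  let Ψ (x : U) : P := (transport ρ σ x.1.1,
    fun α => ⟨J α x - j₀ α, by
      change ρ α ∘ₗ _ = 0
      rw [LinearMap.comp_sub, hρJ, show ρ α ∘ₗ j₀ α = LinearMap.id from hρ α, sub_self]⟩,
    fun β => ⟨Q β x - q₀ β, by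
      change _ ∘ₗ σ β = 0
      rw [LinearMap.sub_comp, hQσ, show q₀ β ∘ₗ σ β = LinearMap.id from hl β, sub_self]⟩)
  have hΨ : (T.sub U).IsRegularMap Ψ := by
    refine isRegularMap_prod.2 ⟨IsRegularMap.transport (fun _ => isRegularMap_const _)
      (fun _ => isRegularMap_const _) hid, isRegularMap_prod.2 ⟨isRegularMap_pi.2 fun α =>
        isRegularMap_submodule.2 ((hJ α).sub_map (isRegularMap_const _)), isRegularMap_pi.2 fun β =>
        isRegularMap_submodule.2 ((hQ β).sub_map (isRegularMap_const _))⟩⟩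
  -- Since the ranks are exactly `u`, dimension counts give im J = im A_α and ker Q = ker A_β, so J
  -- ∘ ρ and σ ∘ Q fix the representation.
  have hΦΨ (x : U) : Φ (Ψ x) = x := by
    have h1 : Φ (Ψ x) = transport (fun α => J α x) (fun β => Q β x) (transport ρ σ x.1.1) := by
      simp [Φ, Ψ]
    rw [h1]
    refine transport_eq_self (fun α => comp_comp_eq_of_range_le (hρJ α x) (ge_of_eq ?_))
      fun β => comp_comp_eq_of_ker_le (hQσ β x) (ge_of_eq ?_)
    · refine Submodule.eq_of_le_of_finrank_eq (LinearMap.range_comp_le_range _ _) ?_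
      rw [LinearMap.finrank_range_of_inj (Function.LeftInverse.injective (g := ρ α)
        (LinearMap.congr_fun (hρJ α x))), Module.finrank_fin_fun]
      exact (x.1.2 (.inl α)).symm
    · refine Submodule.eq_of_le_of_finrank_eq (fun b hb => ?_) ?_
      · simp only [Q, LinearMap.mem_ker, LinearMap.comp_apply] at hb ⊢
        rw [hb, map_zero, map_zero]
      · have h1 := LinearMap.finrank_range_add_finrank_ker (sourceMap x.1.1 β)
        have h2 := LinearMap.finrank_range_add_finrank_ker (Q β x)
        have h3 : Module.finrank ℂ (LinearMap.range (sourceMap x.1.1 β)) = u (.inr β) :=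
          x.1.2 (.inr β)
        rw [LinearMap.range_eq_top.2 (Function.RightInverse.surjective (f := Q β x) (g := σ β)
          (LinearMap.congr_fun (hQσ β x))), finrank_top, Module.finrank_fin_fun] at h2
        omega
  have hΨΦ (p : P) (x : U) (hx : x.1.1 = Φ p) : Ψ x = p := by
    -- The sink map of Φ p starts from the left with the normalized j. Composing with ρ strips it
    -- off, so the remaining factor of J is ρ ∘ J = id. The argument for Q is dual.
    have hx₀ (α : I₀) : J α x = j₀ α + (p.2.1 α).1 := by
      have h1 := hρJ α x
      simp only [J, hx] at h1 ⊢
      rw [sinkMap_transport] at h1 ⊢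
      simp only [← LinearMap.comp_assoc, hρj, LinearMap.id_comp] at h1
      simp only [LinearMap.comp_assoc] at h1 ⊢
      rw [h1, LinearMap.comp_id]
    have hx₁ (β : I₁) : Q β x = q₀ β + (p.2.2 β).1 := by
      have h1 := hQσ β x
      simp only [Q, hx] at h1 ⊢
      rw [sourceMap_transport] at h1 ⊢
      simp only [LinearMap.comp_assoc, hqσ, LinearMap.comp_id] at h1
      simp only [← LinearMap.comp_assoc] at h1 ⊢
      rw [h1, LinearMap.id_comp]
    refine Prod.ext ?_ (Prod.ext (funext fun α => Subtype.ext ?_) (funext fun β => Subtype.ext ?_))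
    · change transport ρ σ x.1.1 = p.1
      rw [hx]
      change transport (fun α => ρ α ∘ₗ (j₀ α + (p.2.1 α).1))
        (fun β => (q₀ β + (p.2.2 β).1) ∘ₗ σ β) p.1 = p.1
      simp only [hρj, hqσ]
      rfl
    · change J α x - j₀ α = _
      rw [hx₀, add_sub_cancel_left]
    · change Q β x - q₀ β = _
      rw [hx₁, add_sub_cancel_left]
  let E : U ≃ V :=
    { toFun := fun x => ⟨Ψ x, by change Φ (Ψ x) ∈ good; rw [hΦΨ]; exact x.2⟩
      invFun := fun p => ⟨⟨Φ p, hΦV p⟩, p.2⟩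
      left_inv := fun x => Subtype.ext (Subtype.ext (hΦΨ x))
      right_inv := fun p => Subtype.ext (hΨΦ p _ rfl) }
  refine hasChartAt_of_finiteDimensional hU hx₀ hV E ⟨?_, ?_⟩
  · exact isMorphism_sub_iff.2 (isMorphism_affineSpace_iff.2 hΨ)
  · exact isMorphism_sub_iff.2 (isMorphism_sub_iff.2 (isMorphism_affineSpace_iff.2 (hΦ.sub V)))

theorem isNonsingular_stratum : ((repSpace Ω w w').sub (stratum Ω u w w')).IsNonsingular :=
  isNonsingular_of_hasChartAt hasChartAt_stratum

theorem isRational_stratum (h : LDominant Ω u w w') :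
    ((repSpace Ω w w').sub (stratum Ω u w w')).IsRational :=
  (isIrred_stratum h).isRational hasChartAt_stratum

/-! ### The stratification by rank vectors. -/

theorem isClosed_vertexRank_le {X : Type*} {S : SpaceWithFunctions X} {e : X → RepSpace Ω w w'}
    (he : S.IsRegularMap e) (k : I₀ ⊕ I₁ → ℕ) :
    @IsClosed _ S.toTopologicalSpace {x | ∀ i, vertexRank (e x) i ≤ k i} := by
  let _ := S.toTopologicalSpace
  simp only [Set.ofPred_forall]
  refine isClosed_iInter fun i => ⟨?_⟩
  -- Ranks being integers, the complement of rank ≤ k is the open set k + 1 ≤ rank.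
  convert isOpen_le_vertexRank he i (k i + 1) using 1
  ext x
  simp

theorem isLocallyClosed_vertexRank_eq {X : Type*} {S : SpaceWithFunctions X}
    {e : X → RepSpace Ω w w'} (he : S.IsRegularMap e) (k : I₀ ⊕ I₁ → ℕ) :
    @IsLocallyClosed _ S.toTopologicalSpace {x | ∀ i, vertexRank (e x) i = k i} := by
  let _ := S.toTopologicalSpace
  refine ⟨_, _, isOpen_le_vertexRank_all k he, isClosed_vertexRank_le he k, ?_⟩
  ext x
  simp [le_antisymm_iff, forall_and, and_comm]

theorem isNonsingular_stratumIn (h : u ≤ v) :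
    ((affineQuiverSpace Ω v w w').sub (stratumIn Ω u v w w')).IsNonsingular := by
  let E : stratumIn Ω u v w w' ≃ stratum Ω u w w' :=
    { toFun := fun x => ⟨x.1.1, x.2⟩
      invFun := fun x => ⟨⟨x.1, fun i => (x.2 i).trans_le (h i)⟩, x.2⟩
      left_inv := fun _ => rfl
      right_inv := fun _ => rfl }
  have hE : IsIsomorphism ((affineQuiverSpace Ω v w w').sub (stratumIn Ω u v w w'))
      ((repSpace Ω w w').sub (stratum Ω u w w')) E :=
    ⟨isMorphism_sub_iff.2 (isMorphism_restrict (isMorphism_val _) _),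
      isMorphism_sub_iff.2 (isMorphism_sub_iff.2 (isMorphism_val _))⟩
  exact hE.isNonsingular isNonsingular_stratum

/-- Each point lies in the stratum of its own rank vector, which is automatically l-dominant. -/
theorem affineQuiverVariety_eq : affineQuiverVariety Ω v w w' =
    ⋃ u ∈ {u : I₀ ⊕ I₁ → ℕ | u ≤ v ∧ LDominant Ω u w w'}, stratum Ω u w w' := by
  ext e
  simp only [Set.mem_iUnion]
  constructor
  · exact fun he => ⟨vertexRank e, ⟨he, lDominant_vertexRank e⟩, fun _ => rfl⟩
  · rintro ⟨u, ⟨hu, -⟩, he⟩ i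
    exact (he i).trans_le (hu i)

theorem isStratification_stratumIn : (affineQuiverSpace Ω v w w').IsStratification
    (fun u : {u : I₀ ⊕ I₁ → ℕ // u ≤ v ∧ LDominant Ω u w w'} => stratumIn Ω u.1 v w w') where
  finite := by
    classical
    exact ((Set.finite_Iic v).subset fun u hu => hu.1).to_subtype
  nonempty u := by
    obtain ⟨e, he⟩ := stratum_nonempty_iff.2 u.2.2
    exact ⟨⟨e, fun i => (he i).trans_le (u.2.1 i)⟩, he⟩
  disjoint u u' h := by
    refine Set.disjoint_left.2 fun x hx hx' => h (Subtype.ext (funext fun i => ?_))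
    exact (hx i).symm.trans (hx' i)
  iUnion_eq := by
    refine Set.eq_univ_of_forall fun e => Set.mem_iUnion.2 ?_
    exact ⟨⟨vertexRank e.1, e.2, lDominant_vertexRank e.1⟩, fun _ => rfl⟩
  isLocallyClosed u := isLocallyClosed_vertexRank_eq
    ((isRegularMap_id (E := RepSpace Ω w w')).sub (affineQuiverVariety Ω v w w')) u.1
  isNonsingular u := isNonsingular_stratumIn u.2.1
  closure_subset u := by
    -- The closed locus of ranks ≤ u contains the stratum, hence its closure, and each of its points
    -- lies in the stratum of its own smaller rank vector.
    have hc := isClosed_vertexRank_le (S := affineQuiverSpace Ω v w w')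
      ((isRegularMap_id (E := RepSpace Ω w w')).sub (affineQuiverVariety Ω v w w')) u.1
    refine (@closure_minimal _ (affineQuiverSpace Ω v w w').toTopologicalSpace
      (stratumIn Ω u.1 v w w') _ (fun x hx i => (hx i).le) hc).trans
        fun x hx => ?_
    simp only [Set.mem_iUnion]
    exact ⟨⟨vertexRank x.1, x.2, lDominant_vertexRank x.1⟩, hx, fun _ => rfl⟩

end Quiver

/-! ### Towers of Grassmannians as locally trivial bundles. -/

section LinearAlgebra

variable {E F : Type*} [AddCommGroup E] [Module ℂ E] [AddCommGroup F] [Module ℂ F]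

theorem map_map_of_comp_eq_id {j : E →ₗ[ℂ] F} {ρ : F →ₗ[ℂ] E} (h : ρ ∘ₗ j = LinearMap.id)
    (V : Submodule ℂ E) : (V.map j).map ρ = V := by
  rw [← Submodule.map_comp, h, Submodule.map_id]

theorem map_map_of_le_range {j : E →ₗ[ℂ] F} {ρ : F →ₗ[ℂ] E} (h : ρ ∘ₗ j = LinearMap.id)
    {V : Submodule ℂ F} (hV : V ≤ LinearMap.range j) : (V.map ρ).map j = V := by
  have key : ∀ x ∈ V, j (ρ x) = x := by
    intro x hx
    obtain ⟨y, rfl⟩ := hV hx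
    rw [show ρ (j y) = y from LinearMap.congr_fun h y]
  ext x
  constructor
  · rintro ⟨_, ⟨y, hy, rfl⟩, rfl⟩
    rwa [key y hy]
  · exact fun hx => ⟨_, ⟨x, hx, rfl⟩, key x hx⟩

theorem finrank_map_of_comp_eq_id {j : E →ₗ[ℂ] F} {ρ : F →ₗ[ℂ] E} (h : ρ ∘ₗ j = LinearMap.id)
    (V : Submodule ℂ E) : Module.finrank ℂ (V.map j) = Module.finrank ℂ V :=
  (Submodule.equivMapOfInjective j
    (Function.LeftInverse.injective (g := ρ) (LinearMap.congr_fun h)) V).symm.finrank_eq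

end LinearAlgebra

section Quiver

open SpaceWithFunctions

variable {I₀ I₁ : Type*} [Fintype I₀] {Ω : I₁ → I₀ → Type*} [∀ β α, Fintype (Ω β α)]

/-- Near `y` the subspaces X_α have regular frames with constant retractions. Together they form an
embedding J of ℂ^N with image ℂ^b ⊕ ⨁ X_{t(h)} and constant retraction P; images under P and J
identify the choices of X_β with points of a fixed Grassmannian. Keeping N apart from its formula
lets it be instantiated with differently written dimensions. -/
theorem isLocallyTrivialBundle_towerProj (d : I₀ ⊕ I₁ → ℕ) (a : I₀ → ℕ) (b N : I₁ → ℕ)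
    (hN : ∀ β, N β = b β + ∑ h : (Σ α, Ω β α), d (.inl h.1)) :
    IsLocallyTrivialBundle ((grProductSpace Ω d a b).sub (towerVariety Ω d a b))
      (SpaceWithFunctions.pi fun α : I₀ => grassmannian (d (.inl α)) (Fin (a α) → ℂ))
      (SpaceWithFunctions.pi fun β : I₁ => grassmannian (d (.inr β)) (Fin (N β) → ℂ))
      (towerProj Ω d a b) := by
  intro y
  choose ρ U j hU hyU hj hρj using fun α => exists_grassmannian_section (y α)
  let T := SpaceWithFunctions.pi fun α : I₀ => grassmannian (d (.inl α)) (Fin (a α) → ℂ)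
  let R := SpaceWithFunctions.pi fun β : I₁ => grassmannian (d (.inr β)) (Fin (N β) → ℂ)
  let O : Set (∀ α : I₀, Gr (d (.inl α)) (Fin (a α) → ℂ)) := ⋂ α, (fun X => X α) ⁻¹' U α
  have hO : IsOpen[T.toTopologicalSpace] O := by
    let _ := T.toTopologicalSpace
    exact isOpen_iInter_of_finite fun α => (isMorphism_apply α).isOpen_preimage (hU α)
  have hmem {X} (hX : X ∈ O) (α : I₀) : X α ∈ U α := Set.mem_iInter.1 hX α
  let ε (β : I₁) : (Fin (N β) → ℂ) ≃ₗ[ℂ]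
      (Fin (b β) → ℂ) × (∀ h : (Σ α, Ω β α), Fin (d (.inl h.1)) → ℂ) :=
    LinearEquiv.ofFinrankEq _ _ (by simp [Module.finrank_pi_fintype, hN])
  let J (β : I₁) (X : ∀ α : I₀, Gr (d (.inl α)) (Fin (a α) → ℂ)) : (Fin (N β) → ℂ) →ₗ[ℂ]
      (Fin (b β) → ℂ) × (∀ h : (Σ α, Ω β α), Fin (a h.1) → ℂ) :=
    (LinearMap.fst ℂ _ _ ∘ₗ (ε β).toLinearMap).prod (LinearMap.pi fun h => j h.1 (X h.1) ∘ₗ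
      LinearMap.proj h ∘ₗ LinearMap.snd ℂ _ _ ∘ₗ (ε β).toLinearMap)
  let P (β : I₁) : (Fin (b β) → ℂ) × (∀ h : (Σ α, Ω β α), Fin (a h.1) → ℂ) →ₗ[ℂ]
      (Fin (N β) → ℂ) :=
    (ε β).symm.toLinearMap ∘ₗ (LinearMap.fst ℂ _ _).prod (LinearMap.pi fun h => ρ h.1 ∘ₗ
      LinearMap.proj h ∘ₗ LinearMap.snd ℂ _ _)
  have hPJ (β : I₁) {X} (hX : X ∈ O) : P β ∘ₗ J β X = LinearMap.id := by
    refine LinearMap.ext fun c => ?_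
    change (ε β).symm ((ε β c).1, fun h => ρ h.1 (j h.1 (X h.1) ((ε β c).2 h))) = c
    rw [LinearEquiv.symm_apply_eq]
    exact Prod.ext rfl (funext fun h =>
      LinearMap.congr_fun (hρj h.1 _ (hmem hX h.1)).1 ((ε β c).2 h))
  have hJ (β : I₁) {X} (hX : X ∈ O) : LinearMap.range (J β X) = Submodule.prod ⊤
      (Submodule.pi Set.univ fun h : (Σ α, Ω β α) => (X h.1).1) := by
    ext c
    constructor
    · rintro ⟨c, rfl⟩
      refine ⟨trivial, fun h _ => ?_⟩
      exact (hρj h.1 _ (hmem hX h.1)).2.le ⟨_, rfl⟩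
    · rintro ⟨-, hc⟩
      have h1 (h : Σ α, Ω β α) : c.2 h ∈ LinearMap.range (j h.1 (X h.1)) := by
        rw [(hρj h.1 _ (hmem hX h.1)).2]
        exact hc h trivial
      choose k hk using h1
      refine ⟨(ε β).symm (c.1, k), ?_⟩
      change ((ε β ((ε β).symm (c.1, k))).1,
        fun h => j h.1 (X h.1) ((ε β ((ε β).symm (c.1, k))).2 h)) = c
      rw [LinearEquiv.apply_symm_apply]
      exact Prod.ext rfl (funext hk)
  have hle (β : I₁) (x : towerProj Ω d a b ⁻¹' O) :
      (x.1.1.2 β).1 ≤ LinearMap.range (J β x.1.1.1) :=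
    (x.1.2 β).trans (hJ β x.2).ge
  let e : towerProj Ω d a b ⁻¹' O ≃ O × (∀ β, Gr (d (.inr β)) (Fin (N β) → ℂ)) :=
    { toFun := fun x => (⟨x.1.1.1, x.2⟩, fun β => ⟨(x.1.1.2 β).1.map (P β), by
        rw [← finrank_map_of_comp_eq_id (hPJ β x.2), map_map_of_le_range (hPJ β x.2) (hle β x)]
        exact (x.1.1.2 β).2⟩)
      invFun := fun p => ⟨⟨(p.1.1, fun β => ⟨(p.2 β).1.map (J β p.1.1), by
        rw [finrank_map_of_comp_eq_id (hPJ β p.1.2)]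
        exact (p.2 β).2⟩), fun β => by
          rw [← hJ β p.1.2]
          exact LinearMap.map_le_range⟩, p.1.2⟩
      left_inv := fun x => Subtype.ext (Subtype.ext (Prod.ext rfl (funext fun β =>
        Subtype.ext (map_map_of_le_range (hPJ β x.2) (hle β x)))))
      right_inv := fun p => Prod.ext rfl (funext fun β =>
        Subtype.ext (map_map_of_comp_eq_id (hPJ β p.1.2) _)) }
  refine ⟨O, hO, Set.mem_iInter.2 hyU, e, ⟨?_, ?_⟩, fun _ => rfl⟩
  · have h1 := isMorphism_restrict (isMorphism_val (S := grProductSpace Ω d a b)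
      (towerVariety Ω d a b)) (towerProj Ω d a b ⁻¹' O)
    have h2 := isMorphism_prod_iff.1 h1
    refine isMorphism_prod_iff.2 ⟨isMorphism_sub_iff.2 h2.1, isMorphism_pi_iff.2 fun β => ?_⟩
    exact isMorphism_grassmannian_map (isMorphism_pi_iff.1 h2.2 β) (isRegularMap_const (P β))
      fun _ => rfl
  · have h1 : IsMorphism ((T.sub O).prod R) T fun p => p.1.1 :=
      (isMorphism_val O).comp isMorphism_fst
    refine isMorphism_sub_iff.2 (isMorphism_sub_iff.2 (isMorphism_prod_iff.2 ⟨h1,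
      isMorphism_pi_iff.2 fun β => ?_⟩))
    refine isMorphism_grassmannian_map (isMorphism_pi_iff.1 isMorphism_snd β)
      (L := fun p => J β p.1.1) ?_ fun _ => rfl
    refine (isRegularMap_const _).lprod (IsRegularMap.lpi fun h => ?_)
    have h2 : IsMorphism ((T.sub O).prod R) ((grassmannian _ _).sub (U h.1)) fun p =>
        ⟨p.1.1 h.1, hmem p.1.2 h.1⟩ := isMorphism_sub_iff.2 (isMorphism_pi_iff.1 h1 h.1)
    exact ((hj h.1).comp h2).lcomp (isRegularMap_const _)

end Quiver

/-! ### Regular local trivializations of cokernels. -/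

section LinearAlgebra

variable {E F G : Type*} [AddCommGroup E] [Module ℂ E] [AddCommGroup F] [Module ℂ F]
  [AddCommGroup G] [Module ℂ G]

theorem finrank_map_add_finrank_ker [FiniteDimensional ℂ E] (p : E →ₗ[ℂ] F) {V : Submodule ℂ E}
    (hV : LinearMap.ker p ≤ V) :
    Module.finrank ℂ (V.map p) + Module.finrank ℂ (LinearMap.ker p) = Module.finrank ℂ V := by
  rw [← LinearMap.finrank_range_add_finrank_ker (p.domRestrict V), LinearMap.range_domRestrict,
    LinearMap.ker_domRestrict]
  congr 1
  exact (Submodule.comapSubtypeEquivOfLe hV).symm.finrank_eq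

/-- This rewrites a preimage as an image plus a kernel, the shape that
`isMorphism_grassmannian_map_sup` shows to vary regularly. -/
theorem comap_eq_map_sup_ker {p : E →ₗ[ℂ] F} {s : F →ₗ[ℂ] E} (h : p ∘ₗ s = LinearMap.id)
    (V : Submodule ℂ F) : V.comap p = V.map s ⊔ LinearMap.ker p := by
  rw [← Submodule.comap_map_eq, map_map_of_comp_eq_id h]

theorem surjective_of_comp_eq_id {p : E →ₗ[ℂ] F} {s : F →ₗ[ℂ] E} (h : p ∘ₗ s = LinearMap.id) :
    Function.Surjective p :=
  Function.RightInverse.surjective (g := s) (LinearMap.congr_fun h)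

theorem exists_isCompl_range [FiniteDimensional ℂ E] (V : Submodule ℂ E) {n : ℕ}
    (hn : Module.finrank ℂ E = Module.finrank ℂ V + n) :
    ∃ ι : (Fin n → ℂ) →ₗ[ℂ] E, Function.Injective ι ∧ IsCompl V (LinearMap.range ι) := by
  obtain ⟨V', hV'⟩ := V.exists_isCompl
  have h := Submodule.finrank_add_eq_of_isCompl hV'
  obtain ⟨ι, ρ, hρ, hι⟩ := exists_range_eq (k := n) V' (by omega)
  exact ⟨ι, Function.LeftInverse.injective (g := ρ) (LinearMap.congr_fun hρ), by rwa [hι]⟩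

end LinearAlgebra

namespace SpaceWithFunctions

variable {Y : Type*} {T : SpaceWithFunctions Y}
variable {E F G : Type*} [AddCommGroup E] [Module ℂ E] [FiniteDimensional ℂ E]
  [AddCommGroup F] [Module ℂ F] [FiniteDimensional ℂ F]
  [AddCommGroup G] [Module ℂ G] [FiniteDimensional ℂ G]

theorem IsRegularMap.mono {E : Type*} [AddCommGroup E] [Module ℂ E] {U V : Set Y} (hVU : V ⊆ U)
    {f : Y → E} (hf : (T.sub U).IsRegularMap fun y => f y) : (T.sub V).IsRegularMap fun y => f y := by
  have h : IsMorphism (T.sub V) (T.sub U) fun y => ⟨y, hVU y.2⟩ :=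
    isMorphism_sub_iff.2 (isMorphism_val V)
  exact hf.comp h

/-- Near a point, a regular family of linear maps `A` of constant rank has a regular family of
projections with kernel `range A`, onto a fixed complement at the given point. -/
theorem exists_local_projection {A : Y → E →ₗ[ℂ] F} (hA : T.IsRegularMap A) {k : ℕ}
    (hk : ∀ y, Module.finrank ℂ (LinearMap.range (A y)) = k) (y₀ : Y) {ι : G →ₗ[ℂ] F}
    (hι : Function.Injective ι) (hcompl : IsCompl (LinearMap.range (A y₀)) (LinearMap.range ι)) :
    ∃ (U : Set Y) (p : Y → F →ₗ[ℂ] G), IsOpen[T.toTopologicalSpace] U ∧ y₀ ∈ U ∧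
      (T.sub U).IsRegularMap (fun y => p y) ∧
      ∀ y ∈ U, p y ∘ₗ ι = LinearMap.id ∧ LinearMap.ker (p y) = LinearMap.range (A y) := by
  classical
  obtain ⟨r, ρ, hρ⟩ := exists_bijective_of_le_finrank_range (hk y₀).ge
  -- At y₀ the first block is a frame of the range and ι a complement, so M is bijective there and
  -- nearby; the second component of its inverse is the projection.
  let M (y : Y) := (A y ∘ₗ r).coprod ι
  have hM : T.IsRegularMap M := (hA.lcomp (isRegularMap_const r)).lcoprod (isRegularMap_const ι)
  let U : Set Y := {y | Function.Bijective (M y)}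
  have hinj : Function.Injective (A y₀ ∘ₗ r) :=
    Function.LeftInverse.injective (g := ρ) (LinearMap.congr_fun hρ)
  have hrange : LinearMap.range (A y₀ ∘ₗ r) = LinearMap.range (A y₀) := by
    refine Submodule.eq_of_le_of_finrank_eq (LinearMap.range_comp_le_range _ _) ?_
    rw [LinearMap.finrank_range_of_inj hinj, Module.finrank_fin_fun, hk]
  have hy₀ : y₀ ∈ U := by
    constructor
    · rw [← LinearMap.ker_eq_bot, LinearMap.ker_coprod_of_disjoint_range _ _
        (by rw [hrange]; exact hcompl.disjoint), LinearMap.ker_eq_bot.2 hinj,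
        LinearMap.ker_eq_bot.2 hι, Submodule.prod_bot]
    · rw [← LinearMap.range_eq_top, LinearMap.range_coprod, hrange]
      exact hcompl.sup_eq_top
  obtain ⟨g, hg, hgM⟩ := (hM.sub U).exists_inverse fun y => y.2
  refine ⟨U, fun y => if h : y ∈ U then LinearMap.snd ℂ _ _ ∘ₗ g ⟨y, h⟩ else 0,
    isOpen_bijective hM, hy₀, ?_, fun y hy => ?_⟩
  · have : (T.sub U).IsRegularMap fun y => LinearMap.snd ℂ _ _ ∘ₗ g y :=
      (isRegularMap_const _).lcomp hg
    convert this using 2 with y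
    exact dif_pos y.2
  · simp only [dif_pos hy]
    have h1 (z) : g ⟨y, hy⟩ (M y z) = z := LinearMap.congr_fun (hgM ⟨y, hy⟩).1 z
    have h2 (x) : M y (g ⟨y, hy⟩ x) = x := LinearMap.congr_fun (hgM ⟨y, hy⟩).2 x
    constructor
    · refine LinearMap.ext fun c => ?_
      have := h1 (0, c)
      simp only [M, LinearMap.coprod_apply, map_zero, zero_add] at this
      simp [this]
    -- The kernel is first seen to be im (A y ∘ r); the constant rank makes this all of im (A y).
    · have hker : LinearMap.ker (LinearMap.snd ℂ _ _ ∘ₗ g ⟨y, hy⟩) =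
          LinearMap.range (A y ∘ₗ r) := by
        ext x
        constructor
        · intro hx
          refine ⟨(g ⟨y, hy⟩ x).1, ?_⟩
          have h3 := h2 x
          have hx' : (g ⟨y, hy⟩ x).2 = 0 := hx
          simp only [M, LinearMap.coprod_apply, hx', map_zero, add_zero] at h3
          exact h3
        · rintro ⟨c, rfl⟩
          have := h1 (c, 0)
          simp only [M, LinearMap.coprod_apply, map_zero, add_zero] at this
          exact congrArg Prod.snd this
      rw [hker]
      refine Submodule.eq_of_le_of_finrank_eq (LinearMap.range_comp_le_range _ _) ?_
      rw [LinearMap.finrank_range_of_inj, Module.finrank_fin_fun, hk]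
      intro c c' hc
      have : M y (c, 0) = M y (c', 0) := by simpa [M] using hc
      exact congrArg Prod.fst (hy.1 this)

end SpaceWithFunctions

/-! ### Compatible splittings and the bundle π over a stratum. -/

section Quiver

open SpaceWithFunctions

variable {I₀ I₁ : Type*} [Fintype I₀] [Fintype I₁] {Ω : I₁ → I₀ → Type*} [∀ β α, Fintype (Ω β α)]
variable {u v w w' : I₀ ⊕ I₁ → ℕ}

/-- The component at `h` is y_h(b), the value of A_{t(h)} on `b` placed in the summand of `h`. Hence
projections modulo im A_{t(h)} kill the arrow components of A_β. -/
theorem sourceMap_mem_range_sinkMap (e : RepSpace Ω w w') (β : I₁) (h : Σ α, Ω β α) (b) :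
    (sourceMap e β b).2 h ∈ LinearMap.range (sinkMap e h.1) := by
  classical
  refine ⟨(0, Pi.single ⟨β, h.2⟩ b), ?_⟩
  rw [sinkMap_apply, map_zero, zero_add, Finset.sum_eq_single ⟨β, h.2⟩]
  · simp [sourceMap]
  · intro k _ hk; simp [hk]
  · simp

/-- Near a point of a family with constant ranks, the cokernels of the maps at the vertices have
regular trivializations that are compatible along the arrows. -/
theorem exists_local_splitting {Y : Type*} {T : SpaceWithFunctions Y} {e : Y → RepSpace Ω w w'}
    (he : T.IsRegularMap e) (hu : ∀ y i, vertexRank (e y) i = u i) (h : LDominant Ω u w w')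
    (y₀ : Y) :
    ∃ (U : Set Y)
      (p₀ : ∀ α : I₀, Y → (Fin (w (.inl α)) → ℂ) →ₗ[ℂ] (Fin (sinkDim u w α) → ℂ))
      (s₀ : ∀ α : I₀, Y → (Fin (sinkDim u w α) → ℂ) →ₗ[ℂ] (Fin (w (.inl α)) → ℂ))
      (p₁ : ∀ β : I₁, Y →
        ((Fin (w' (.inr β)) → ℂ) × (∀ h : (Σ α, Ω β α), Fin (w (.inl h.1)) → ℂ)) →ₗ[ℂ]
        ((Fin (sourceDim Ω u w' β) → ℂ) × (∀ h : (Σ α, Ω β α), Fin (sinkDim u w h.1) → ℂ)))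
      (s₁ : ∀ β : I₁, Y →
        ((Fin (sourceDim Ω u w' β) → ℂ) × (∀ h : (Σ α, Ω β α), Fin (sinkDim u w h.1) → ℂ)) →ₗ[ℂ]
        ((Fin (w' (.inr β)) → ℂ) × (∀ h : (Σ α, Ω β α), Fin (w (.inl h.1)) → ℂ))),
      IsOpen[T.toTopologicalSpace] U ∧ y₀ ∈ U ∧
      (∀ α, (T.sub U).IsRegularMap fun y => p₀ α y) ∧
      (∀ α, (T.sub U).IsRegularMap fun y => s₀ α y) ∧
      (∀ β, (T.sub U).IsRegularMap fun y => p₁ β y) ∧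
      (∀ β, (T.sub U).IsRegularMap fun y => s₁ β y) ∧
      ∀ y ∈ U, (∀ α, p₀ α y ∘ₗ s₀ α y = LinearMap.id) ∧
        (∀ α, LinearMap.ker (p₀ α y) = LinearMap.range (sinkMap (e y) α)) ∧
        (∀ β, p₁ β y ∘ₗ s₁ β y = LinearMap.id) ∧
        (∀ β, LinearMap.ker (p₁ β y) = LinearMap.range (sourceMap (e y) β)) ∧
        ∀ β x h, (p₁ β y x).2 h = p₀ h.1 y (x.2 h) := by
  let _ := T.toTopologicalSpace
  obtain ⟨hle, -, h₁⟩ := lDominant_iff.1 h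
  have hrk₀ (α : I₀) (y : Y) : Module.finrank ℂ (LinearMap.range (sinkMap (e y) α)) = u (.inl α) :=
    hu y (.inl α)
  have hrk₁ (β : I₁) (y : Y) :
      Module.finrank ℂ (LinearMap.range (sourceMap (e y) β)) = u (.inr β) := hu y (.inr β)
  choose s hs hsc using fun α => exists_isCompl_range (n := sinkDim u w α)
    (LinearMap.range (sinkMap (e y₀) α)) (by
      rw [hrk₀, Module.finrank_fin_fun, sinkDim]
      have := hle (.inl α)
      omega)
  choose U₀ p₀ hU₀ hy₀ hp₀ hp₀' using fun α =>
    exists_local_projection (IsRegularMap.sinkMap he α) (hrk₀ α) y₀ (hs α) (hsc α)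
  let P (β : I₁) (y : Y) : ((Fin (w' (.inr β)) → ℂ) × (∀ h : (Σ α, Ω β α),
      Fin (w (.inl h.1)) → ℂ)) →ₗ[ℂ] (∀ h : (Σ α, Ω β α), Fin (sinkDim u w h.1) → ℂ) :=
    LinearMap.pi fun h => p₀ h.1 y ∘ₗ LinearMap.proj h ∘ₗ LinearMap.snd ℂ _ _
  let inc (β : I₁) : (∀ h : (Σ α, Ω β α), Fin (sinkDim u w h.1) → ℂ) →ₗ[ℂ]
      ((Fin (w' (.inr β)) → ℂ) × (∀ h : (Σ α, Ω β α), Fin (w (.inl h.1)) → ℂ)) :=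
    LinearMap.inr ℂ _ _ ∘ₗ LinearMap.pi fun h => s h.1 ∘ₗ LinearMap.proj h
  have hPs (β : I₁) {y : Y} (hy : ∀ α, y ∈ U₀ α) (c) : P β y (inc β c) = c :=
    funext fun h => LinearMap.congr_fun (hp₀' h.1 y (hy h.1)).1 (c h)
  have hPA (β : I₁) {y : Y} (hy : ∀ α, y ∈ U₀ α) (b) : P β y (sourceMap (e y) β b) = 0 :=
    funext fun h => (hp₀' h.1 y (hy h.1)).2.ge (sourceMap_mem_range_sinkMap (e y) β h b)
  have hdisj (β : I₁) :
      Disjoint (LinearMap.range (sourceMap (e y₀) β)) (LinearMap.range (inc β)) := by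
    rw [Submodule.disjoint_def]
    rintro _ ⟨b, rfl⟩ ⟨c, hc⟩
    have := hPs β hy₀ c
    rw [hc, hPA β hy₀] at this
    rw [← hc, ← this, map_zero]
  have hinc (β : I₁) : Function.Injective (inc β) :=
    Function.LeftInverse.injective (g := P β y₀) (hPs β hy₀)
  -- `inc` embeds the sum of the chosen complements at the sinks and meets im A_β only in 0, since P
  -- kills im A_β and is a left inverse of `inc`. Dominance makes the dimension left over equal to
  -- `sourceDim`.
  choose ι hι hιc using fun β => exists_isCompl_range (n := sourceDim Ω u w' β)
    (LinearMap.range (sourceMap (e y₀) β) ⊔ LinearMap.range (inc β)) (by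
      have h2 := Submodule.finrank_sup_add_finrank_inf_eq
        (LinearMap.range (sourceMap (e y₀) β)) (LinearMap.range (inc β))
      rw [(hdisj β).eq_bot, finrank_bot, add_zero, hrk₁,
        LinearMap.finrank_range_of_inj (hinc β), Module.finrank_pi_fintype] at h2
      simp only [Module.finrank_fin_fun] at h2
      rw [h2, finrank_source, sourceDim]
      have h3 : ∑ h : (Σ α, Ω β α), w (.inl h.1) = ∑ h : (Σ α, Ω β α), u (.inl h.1) +
          ∑ h : (Σ α, Ω β α), sinkDim u w h.1 := by
        rw [← Finset.sum_add_distrib]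
        refine Finset.sum_congr rfl fun h _ => ?_
        have := hle (.inl h.1)
        rw [sinkDim]
        omega
      have := h₁ β
      omega)
  have hinj (β : I₁) : Function.Injective ((ι β).coprod (inc β)) := by
    rw [← LinearMap.ker_eq_bot, LinearMap.ker_coprod_of_disjoint_range _ _
      ((hιc β).disjoint.mono_left le_sup_right).symm, LinearMap.ker_eq_bot.2 (hι β),
      LinearMap.ker_eq_bot.2 (hinc β), Submodule.prod_bot]
  have hcompl (β : I₁) : IsCompl (LinearMap.range (sourceMap (e y₀) β))
      (LinearMap.range ((ι β).coprod (inc β))) := by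
    rw [LinearMap.range_coprod, sup_comm]
    exact (hdisj β).isCompl_sup_right_of_isCompl_sup_left (hιc β)
  choose U₁ p' hU₁ hy₁ hp' hp'' using fun β =>
    exists_local_projection (IsRegularMap.sourceMap he β) (hrk₁ β) y₀ (hinj β) (hcompl β)
  let U : Set Y := (⋂ α, U₀ α) ∩ ⋂ β, U₁ β
  have hUU₀ (α : I₀) : U ⊆ U₀ α := Set.inter_subset_left.trans (Set.iInter_subset _ α)
  have hUU₁ (β : I₁) : U ⊆ U₁ β := Set.inter_subset_right.trans (Set.iInter_subset _ β)
  have hp₀U (α : I₀) : (T.sub U).IsRegularMap fun y => p₀ α y := (hp₀ α).mono (hUU₀ α)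
  have hPU (β : I₁) : (T.sub U).IsRegularMap fun y => P β y :=
    IsRegularMap.lpi fun h => (hp₀U h.1).lcomp (isRegularMap_const _)
  -- The second component of p' need not be compatible with p₀, so it is replaced by P. The section
  -- gets a matching correction: subtracting P(ι c₁) from c₂ makes P take the value c₂ on it.
  refine ⟨U, p₀, fun α _ => s α, fun β y => (LinearMap.fst ℂ _ _ ∘ₗ p' β y).prod (P β y),
    fun β y => ι β ∘ₗ LinearMap.fst ℂ _ _ + inc β ∘ₗ (LinearMap.snd ℂ _ _ -
      P β y ∘ₗ ι β ∘ₗ LinearMap.fst ℂ _ _),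
    (isOpen_iInter_of_finite hU₀).inter (isOpen_iInter_of_finite hU₁),
    ⟨Set.mem_iInter.2 hy₀, Set.mem_iInter.2 hy₁⟩, hp₀U, fun α => isRegularMap_const _,
    fun β => ?_, fun β => ?_, fun y hy => ⟨fun α => (hp₀' α y (hUU₀ α hy)).1,
      fun α => (hp₀' α y (hUU₀ α hy)).2, fun β => ?_, fun β => ?_, fun β x h => rfl⟩⟩
  · exact ((isRegularMap_const _).lcomp ((hp' β).mono (hUU₁ β))).lprod (hPU β)
  · exact (isRegularMap_const _).add ((isRegularMap_const _).lcomp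
      ((isRegularMap_const _).sub_map ((hPU β).lcomp (isRegularMap_const _))))
  · refine LinearMap.ext fun c => ?_
    have h1 (c) : p' β y (ι β c.1 + inc β c.2) = c :=
      LinearMap.congr_fun (hp'' β y (hUU₁ β hy)).1 c
    refine Prod.ext ?_ ?_
    · have h2 := congrArg Prod.fst (h1 (c.1, c.2 - P β y (ι β c.1)))
      exact h2
    · change P β y (ι β c.1 + inc β (c.2 - P β y (ι β c.1))) = c.2
      rw [map_add, hPs β fun α => hUU₀ α hy, add_sub_cancel]
  · have h1 (c) : p' β y (ι β c.1 + inc β c.2) = c :=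
      LinearMap.congr_fun (hp'' β y (hUU₁ β hy)).1 c
    have h2 := (hp'' β y (hUU₁ β hy)).2
    ext x
    constructor
    · intro hx
      have hx1 : (p' β y x).1 = 0 := congrArg Prod.fst hx
      have hx2 : P β y x = 0 := congrArg Prod.snd hx
      -- Replacing the component keeps the kernel: x minus its `inc` part lies in im A_β, and
      -- applying P forces that part to vanish.
      obtain ⟨b, hb⟩ : x - inc β (p' β y x).2 ∈ LinearMap.range (sourceMap (e y) β) := by
        rw [← h2, LinearMap.mem_ker, map_sub, sub_eq_zero]
        have := h1 (p' β y x)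
        rw [hx1, map_zero, zero_add] at this
        exact this.symm
      have h3 := hPA β (fun α => hUU₀ α hy) b
      rw [hb, map_sub, hx2, hPs β fun α => hUU₀ α hy, zero_sub, neg_eq_zero] at h3
      rw [h3, map_zero, sub_zero] at hb
      exact ⟨b, hb⟩
    · rintro ⟨b, rfl⟩
      have h3 : p' β y (sourceMap (e y) β b) = 0 := h2.ge ⟨b, rfl⟩
      have h4 := congrArg Prod.fst h3
      exact Prod.ext h4 (hPA β (fun α => hUU₀ α hy) b)

/-- Over U the subspaces X_i containing im A_i = ker p_i correspond to their images under p_i, of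
dimension v_i - u_i, with inverse given by preimages. Compatibility of p₁ with p₀ on the arrow
components matches the two tower conditions. -/
theorem isLocallyTrivialBundle_quiverProj (huv : u ≤ v) (h : LDominant Ω u w w') :
    IsLocallyTrivialBundle
      ((nonsingularQuiverSpace Ω v w w').sub (quiverProj Ω v w w' ⁻¹' stratumIn Ω u v w w'))
      ((affineQuiverSpace Ω v w w').sub (stratumIn Ω u v w w'))
      (fiberSpace Ω u v w w')
      ((stratumIn Ω u v w w').restrictPreimage (quiverProj Ω v w w')) := by
  intro y₀
  let T := (affineQuiverSpace Ω v w w').sub (stratumIn Ω u v w w')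
  let S := (nonsingularQuiverSpace Ω v w w').sub (quiverProj Ω v w w' ⁻¹' stratumIn Ω u v w w')
  let f := (stratumIn Ω u v w w').restrictPreimage (quiverProj Ω v w w')
  have he : T.IsRegularMap fun y => y.1.1 := (isRegularMap_id (E := RepSpace Ω w w')).sub _ |>.sub _
  obtain ⟨U, p₀, s₀, p₁, s₁, hU, hy₀, hp₀, hs₀, hp₁, hs₁, hU'⟩ :=
    exists_local_splitting he (fun y i => y.2 i) h y₀
  have key₀ (y : U) (α : I₀) := (hU' y y.2).1 α
  have ker₀ (y : U) (α : I₀) := (hU' y y.2).2.1 α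
  have key₁ (y : U) (β : I₁) := (hU' y y.2).2.2.1 β
  have ker₁ (y : U) (β : I₁) := (hU' y y.2).2.2.2.1 β
  have compat (y : U) (β : I₁) := (hU' y y.2).2.2.2.2 β
  have rk₀ (y : U) (α : I₀) : Module.finrank ℂ (LinearMap.ker (p₀ α y)) = u (.inl α) := by
    rw [ker₀]; exact y.1.2 (.inl α)
  have rk₁ (y : U) (β : I₁) : Module.finrank ℂ (LinearMap.ker (p₁ β y)) = u (.inr β) := by
    rw [ker₁]; exact y.1.2 (.inr β)
  have le₀ (x : f ⁻¹' U) (α : I₀) : LinearMap.ker (p₀ α (f x)) ≤ (x.1.1.1.2.1 α).1 :=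
    (ker₀ ⟨f x, x.2⟩ α).trans_le (x.1.1.2.2.1 α)
  have le₁ (x : f ⁻¹' U) (β : I₁) : LinearMap.ker (p₁ β (f x)) ≤ (x.1.1.1.2.2 β).1 :=
    (ker₁ ⟨f x, x.2⟩ β).trans_le (x.1.1.2.2.2 β)
  let toFib (x : f ⁻¹' U) : fiberVariety Ω u v w w' :=
    ⟨(fun α => ⟨(x.1.1.1.2.1 α).1.map (p₀ α (f x)), by
        have h1 := finrank_map_add_finrank_ker _ (le₀ x α)
        rw [rk₀ ⟨f x, x.2⟩] at h1
        exact Nat.eq_sub_of_add_eq (h1.trans (x.1.1.1.2.1 α).2)⟩,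
      fun β => ⟨(x.1.1.1.2.2 β).1.map (p₁ β (f x)), by
        have h1 := finrank_map_add_finrank_ker _ (le₁ x β)
        rw [rk₁ ⟨f x, x.2⟩] at h1
        exact Nat.eq_sub_of_add_eq (h1.trans (x.1.1.1.2.2 β).2)⟩), fun β => by
      rintro _ ⟨c, hc, rfl⟩
      refine ⟨trivial, fun h _ => ⟨c.2 h, (x.1.1.2.1 β hc).2 h trivial, ?_⟩⟩
      exact (compat ⟨f x, x.2⟩ β c h).symm⟩
  let ofFib (q : U × fiberVariety Ω u v w w') : f ⁻¹' U :=
    ⟨⟨⟨(q.1.1.1.1, (fun α => ⟨(q.2.1.1 α).1.comap (p₀ α q.1), by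
        have h1 := finrank_map_add_finrank_ker (p₀ α q.1)
          (V := (q.2.1.1 α).1.comap (p₀ α q.1)) (LinearMap.ker_le_comap _)
        rw [Submodule.map_comap_eq_of_surjective (surjective_of_comp_eq_id (key₀ q.1 α)), rk₀,
          (q.2.1.1 α).2] at h1
        exact h1.symm.trans (Nat.sub_add_cancel (huv _))⟩,
      fun β => ⟨(q.2.1.2 β).1.comap (p₁ β q.1), by
        have h1 := finrank_map_add_finrank_ker (p₁ β q.1)
          (V := (q.2.1.2 β).1.comap (p₁ β q.1)) (LinearMap.ker_le_comap _)
        rw [Submodule.map_comap_eq_of_surjective (surjective_of_comp_eq_id (key₁ q.1 β)), rk₁,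
          (q.2.1.2 β).2] at h1
        exact h1.symm.trans (Nat.sub_add_cancel (huv _))⟩)), by
      refine ⟨fun β c hc => ⟨trivial, fun h _ => ?_⟩, fun α => ?_, fun β => ?_⟩
      · have := (q.2.2 β hc).2 h trivial
        rw [compat q.1 β c h] at this
        exact this
      · exact (ker₀ q.1 α).ge.trans (LinearMap.ker_le_comap _)
      · exact (ker₁ q.1 β).ge.trans (LinearMap.ker_le_comap _)⟩, q.1.1.2⟩, q.1.2⟩
  let E : f ⁻¹' U ≃ U × fiberVariety Ω u v w w' :=
    { toFun := fun x => (⟨f x, x.2⟩, toFib x)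
      invFun := ofFib
      left_inv := fun x => by
        refine Subtype.ext (Subtype.ext (Subtype.ext (Prod.ext rfl (Prod.ext
          (funext fun α => Subtype.ext ?_) (funext fun β => Subtype.ext ?_)))))
        · exact (Submodule.comap_map_eq _ _).trans (sup_eq_left.2 (le₀ x α))
        · exact (Submodule.comap_map_eq _ _).trans (sup_eq_left.2 (le₁ x β))
      right_inv := fun q => by
        refine Prod.ext rfl (Subtype.ext (Prod.ext
          (funext fun α => Subtype.ext ?_) (funext fun β => Subtype.ext ?_)))
        · exact Submodule.map_comap_eq_of_surjective (surjective_of_comp_eq_id (key₀ q.1 α)) _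
        · exact Submodule.map_comap_eq_of_surjective (surjective_of_comp_eq_id (key₁ q.1 β)) _ }
  refine ⟨U, hU, hy₀, E, ⟨?_, ?_⟩, fun _ => rfl⟩
  · have h1 : IsMorphism (S.sub (f ⁻¹' U))
        ((repSpace Ω w w').prod (grProductSpace Ω v (w ∘ .inl) (w' ∘ .inr)))
        fun x => x.1.1.1 :=
      isMorphism_restrict (isMorphism_restrict (isMorphism_val _) _) _
    have h2 := isMorphism_prod_iff.1 h1
    have h3 := isMorphism_prod_iff.1 h2.2
    have h4 : IsMorphism (S.sub (f ⁻¹' U)) (T.sub U) fun x => ⟨f x, x.2⟩ :=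
      isMorphism_sub_iff.2 (isMorphism_sub_iff.2 (isMorphism_sub_iff.2 h2.1))
    refine isMorphism_prod_iff.2 ⟨h4, isMorphism_sub_iff.2 (isMorphism_prod_iff.2
      ⟨isMorphism_pi_iff.2 fun α => ?_, isMorphism_pi_iff.2 fun β => ?_⟩)⟩
    · exact isMorphism_grassmannian_map (isMorphism_pi_iff.1 h3.1 α) ((hp₀ α).comp h4)
        fun _ => rfl
    · exact isMorphism_grassmannian_map (isMorphism_pi_iff.1 h3.2 β) ((hp₁ β).comp h4)
        fun _ => rfl
  · have h1 : IsMorphism ((T.sub U).prod (fiberSpace Ω u v w w')) (T.sub U) fun q => q.1 :=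
      isMorphism_fst
    have h2 : IsMorphism ((T.sub U).prod (fiberSpace Ω u v w w'))
        (grProductSpace Ω (v - u) (sinkDim u w) (sourceDim Ω u w')) fun q => q.2.1 :=
      (isMorphism_val _).comp isMorphism_snd
    have h3 := isMorphism_prod_iff.1 h2
    have h4 : ((T.sub U).prod (fiberSpace Ω u v w w')).IsRegularMap fun q => q.1.1.1.1 :=
      (he.sub U).comp h1
    refine isMorphism_sub_iff.2 (isMorphism_sub_iff.2 (isMorphism_sub_iff.2 (isMorphism_prod_iff.2
      ⟨isMorphism_affineSpace_iff.2 h4, isMorphism_prod_iff.2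
        ⟨isMorphism_pi_iff.2 fun α => ?_, isMorphism_pi_iff.2 fun β => ?_⟩⟩)))
    -- The preimage of X'_α under p₀ is s₀(X'_α) + im A_α, a sum of regularly varying subspaces; the
    -- sources are treated alike.
    · refine isMorphism_grassmannian_map_sup (isMorphism_pi_iff.1 h3.1 α) ((hs₀ α).comp h1)
        (IsRegularMap.sinkMap h4 α) fun q => ?_
      rw [← ker₀ q.1 α]
      exact comap_eq_map_sup_ker (key₀ q.1 α) _
    · refine isMorphism_grassmannian_map_sup (isMorphism_pi_iff.1 h3.2 β) ((hs₁ β).comp h1)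
        (IsRegularMap.sourceMap h4 β) fun q => ?_
      rw [← ker₁ q.1 β]
      exact comap_eq_map_sup_ker (key₁ q.1 β) _

end Quiver

theorem lemma3p5 {I₀ I₁ : Type*} [Fintype I₀] [Fintype I₁]
    (Ω : I₁ → I₀ → Type*) [∀ β α, Fintype (Ω β α)] (v w w' : I₀ ⊕ I₁ → ℕ) :
    -- (a) the strata
    (∀ u, u ≤ v →
      ((stratum Ω u w w').Nonempty ↔ LDominant Ω u w w') ∧
      (LDominant Ω u w w' →
        ((repSpace Ω w w').sub (stratum Ω u w w')).IsNonsingular ∧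
        @IsLocallyClosed _ (repSpace Ω w w').toTopologicalSpace (stratum Ω u w w') ∧
        @IsLocallyClosed _ (affineQuiverSpace Ω v w w').toTopologicalSpace
          (stratumIn Ω u v w w') ∧
        ((repSpace Ω w w').sub (stratum Ω u w w')).IsIrred ∧
        ((repSpace Ω w w').sub (stratum Ω u w w')).IsRational)) ∧
    -- (a) the stratification of `E_{v,w}`
    affineQuiverVariety Ω v w w' =
      (⋃ u ∈ {u : I₀ ⊕ I₁ → ℕ | u ≤ v ∧ LDominant Ω u w w'}, stratum Ω u w w') ∧
    (affineQuiverSpace Ω v w w').IsStratification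
      (fun u : {u : I₀ ⊕ I₁ → ℕ // u ≤ v ∧ LDominant Ω u w w'} => stratumIn Ω u.1 v w w') ∧
    -- (b) the restriction of `π` to a stratum, and the structure of its fiber
    (∀ u, u ≤ v → LDominant Ω u w w' →
      SpaceWithFunctions.IsLocallyTrivialBundle
        ((nonsingularQuiverSpace Ω v w w').sub (quiverProj Ω v w w' ⁻¹' stratumIn Ω u v w w'))
        ((affineQuiverSpace Ω v w w').sub (stratumIn Ω u v w w'))
        (fiberSpace Ω u v w w')
        ((stratumIn Ω u v w w').restrictPreimage (quiverProj Ω v w w')) ∧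
      SpaceWithFunctions.IsLocallyTrivialBundle
        (fiberSpace Ω u v w w')
        (SpaceWithFunctions.pi fun α : I₀ =>
          grassmannian (v (.inl α) - u (.inl α)) (Fin (w (.inl α) - u (.inl α)) → ℂ))
        (SpaceWithFunctions.pi fun β : I₁ =>
          grassmannian (v (.inr β) - u (.inr β))
            (Fin (w' (.inr β) + (∑ h : (Σ α, Ω β α), v (.inl h.1)) - u (.inr β)) → ℂ))
        (towerProj Ω (v - u) (sinkDim u w) (sourceDim Ω u w'))) ∧
    -- (b) the variety `F_{v,w}`
    SpaceWithFunctions.IsLocallyTrivialBundle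
      (flagSpace Ω v w w')
      (SpaceWithFunctions.pi fun α : I₀ => grassmannian (v (.inl α)) (Fin (w (.inl α)) → ℂ))
      (SpaceWithFunctions.pi fun β : I₁ =>
        grassmannian (v (.inr β))
          (Fin (w' (.inr β) + ∑ h : (Σ α, Ω β α), v (.inl h.1)) → ℂ))
      (towerProj Ω v (w ∘ .inl) (w' ∘ .inr)) := by
  refine ⟨fun u huv => ⟨stratum_nonempty_iff, fun h => ⟨isNonsingular_stratum, ?_, ?_,
    isIrred_stratum h, isRational_stratum h⟩⟩, affineQuiverVariety_eq, isStratification_stratumIn,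
    fun u huv h => ⟨isLocallyTrivialBundle_quiverProj huv h, ?_⟩, ?_⟩
  · exact isLocallyClosed_vertexRank_eq SpaceWithFunctions.isRegularMap_id u
  · exact isStratification_stratumIn.isLocallyClosed ⟨u, huv, h⟩
  · refine isLocallyTrivialBundle_towerProj (v - u) (sinkDim u w) (sourceDim Ω u w') _ fun β => ?_
    -- Dominance makes the natural-number subtraction in `sourceDim` exact, so that adding ∑ (v - u)
    -- turns ∑ u into ∑ v.
    have h₁ := (lDominant_iff.1 h).2.2 β
    have h₂ : ∑ h : (Σ α, Ω β α), v (.inl h.1) = ∑ h : (Σ α, Ω β α), u (.inl h.1) +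
        ∑ h : (Σ α, Ω β α), (v - u) (.inl h.1) := by
      rw [← Finset.sum_add_distrib]
      exact Finset.sum_congr rfl fun h _ => (Nat.add_sub_cancel' (huv (.inl h.1))).symm
    rw [sourceDim]
    omega
  · exact isLocallyTrivialBundle_towerProj v (w ∘ .inl) (w' ∘ .inr) _ fun _ => rfl
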